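/- Setting. Let $\mathcal G$ be a connected undirected graph on a finite agent set $\mathcal V$ and let $\mathcal N_i$ be the neighbourhood of agent $i$, including $i$ itself. Let $A=[a_{ij}]$ be a doubly stochastic matrix such that, for some constant $c>0$, $a_{ij}>c$ for $j\in\mathcal N_i$ and $a_{ij}=0$ for $j\notin\mathcal N_i$. For $i\in\mathcal V$ let $f_i(x)=\mathbb E_{\xi_i\sim\mathcal D_i}[\ell_i(x,\xi_i)]$, $x\in\mathbb R^d$, be differentiable with Lipschitz continuous gradient and $\mu$-strongly convex, i.e. $\langle\nabla f_i(x)-\nabla f_i(y),x-y\rangle\ge\mu\|x-y\|^2$ for all $x,y$, where $\mu>0$ is common to all $i$; put $f=\sum_{i\in\mathcal V} f_i$. The sampled gradients $g_i(x,\xi)$ satisfy, for $\xi\sim\mathcal D_i$ and every $x\in\mathbb R^d$, $\mathbb E[g_i(x,\xi)]=\nabla f_i(x)$ and $\mathbb E[\|g_i(x,\xi)-\nabla f_i(x)\|^2]\le\sigma_g^2$, with a constant $\sigma_g$ that does not depend on $i$ and $x$. Algorithm 2. From arbitrary initial values $x_{i,0}\in\mathbb R^d$, each agent $i\in\mathcal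 V$ iterates, for $k=0,1,2,\dots$, $$x_{i,k+1}=(1-\beta_k)x_{i,k}+\beta_k\sum_{j\in\mathcal N_i}a_{ij}x_{j,k}-\alpha_k\Big(\frac1{\gamma_k}\sum_{l=1}^{\gamma_k}g_i(x_{i,k},\xi_{i}^{k,l})+n_{i,k}\Big).$$ Here the samples $\xi_i^{k,1},\dots,\xi_i^{k,\gamma_k}$ are independent with law $\mathcal D_i$; the noise vectors $n_{i,k}\in\mathbb R^d$ have zero-mean Laplace distributed entries with variance $2\sigma_k^2$, where $\sigma_k>0$; at each iteration, the noise vectors are independent over the agents and of the samples; and the samples and noises of different iterations are independent. Theorem (convergence rate of Algorithm 2). Let $\alpha_k=\frac{a_1}{(k+a_2)^{\alpha}}$, $\beta_k=\frac{a_1}{(k+a_2)^{\beta}}$, $\gamma_k=\lceil a_3(k+a_2)^{\gamma}\rceil$ and $\sigma_k=O((k+a_2)^{\eta})$ as $k\to\infty$, where $a_1,a_2,a_3>0$, $0<\beta<\alpha\le1$, $\gamma\ge0$ and $0\le\eta\le\min\{\frac{\beta}{2},\frac{\alpha-\beta}{2}\}$. Then $f$ has a unique minimizer $x^*$, all $\mathbb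 E[\|x_{i,k}-x^*\|^2]$ are finite, and for every $i\in\mathcal V$, as $k\to\infty$: when $\alpha<1$, $$\mathbb E[\|x_{i,k}-x^*\|^2]=O\Big(\frac1{(k+a_2)^{\min\{\beta-2\eta,\ \alpha-\beta-2\eta\}}}\Big);$$ when $\alpha=1$, $$\mathbb E[\|x_{i,k}-x^*\|^2]=O\Big(\frac{\ln k}{(k+a_2)^{\min\{a_1\mu-1+\beta,\ \beta-2\eta,\ 1-\beta-2\eta\}}}\Big).$$ -/

import Mathlib

open MeasureTheory ProbabilityTheory Filter Asymptotics
open scoped Matrix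

namespace DPOpt

/-- The decision space `ℝ^d` with its Euclidean norm. -/
abbrev E (d : ℕ) : Type := EuclideanSpace ℝ (Fin d)

/-- The zero-mean Laplace distribution with scale `b > 0`, that is, with density
`exp (-|x| / b) / (2 b)` and variance `2 b ^ 2`. -/
noncomputable def laplaceMeasure (b : ℝ) : Measure ℝ :=
  volume.withDensity fun x => ENNReal.ofReal (Real.exp (-|x| / b) / (2 * b))

/-- The polynomial step size `a₁ / (k + a₂) ^ p`. -/
noncomputable def stepSize (a₁ a₂ p : ℝ) (k : ℕ) : ℝ :=
  a₁ / ((k : ℝ) + a₂) ^ p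

/-- The number of samples `⌈a₃ (k + a₂) ^ γ⌉` drawn by each agent at iteration `k`. -/
noncomputable def sampleSize (a₃ a₂ γ : ℝ) (k : ℕ) : ℕ :=
  ⌈a₃ * ((k : ℝ) + a₂) ^ γ⌉₊

section Problem

variable {V : Type*} {d : ℕ} {Ξ : V → Type*} [∀ i, MeasurableSpace (Ξ i)]

/-- The local objective `f_i(x) = 𝔼_{ξ ∼ D_i} [ℓ_i(x, ξ)]`. -/
noncomputable def localCost (D : ∀ i, Measure (Ξ i)) (l : ∀ i, E d → Ξ i → ℝ) (i : V) (x : E d) :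
    ℝ :=
  ∫ z, l i x z ∂(D i)

/-- The global objective `f = ∑ i, f_i`. -/
noncomputable def globalCost [Fintype V] (D : ∀ i, Measure (Ξ i)) (l : ∀ i, E d → Ξ i → ℝ)
    (x : E d) : ℝ :=
  ∑ i, localCost D l i x

/-- The local objectives are well defined and differentiable, with Lipschitz continuous gradients,
and `μ`-strongly convex with a common `μ > 0`. -/
structure RegularCosts (D : ∀ i, Measure (Ξ i)) (l : ∀ i, E d → Ξ i → ℝ) (μ : ℝ) : Prop where
  integrable : ∀ i x, Integrable (l i x) (D i)
  differentiable : ∀ i, Differentiable ℝ (localCost D l i)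
  lipschitz : ∀ i, ∃ L : ℝ, 0 < L ∧ ∀ x y,
    ‖gradient (localCost D l i) x - gradient (localCost D l i) y‖ ≤ L * ‖x - y‖
  mu_pos : 0 < μ
  strongly_convex : ∀ i x y,
    μ * ‖x - y‖ ^ 2 ≤
      inner ℝ (gradient (localCost D l i) x - gradient (localCost D l i) y) (x - y)

/-- The sampled gradients `g_i(x, ξ)` are unbiased, with variance bounded uniformly
by `σ_g ^ 2`. -/
structure UnbiasedOracle (D : ∀ i, Measure (Ξ i)) (l : ∀ i, E d → Ξ i → ℝ)
    (g : ∀ i, E d → Ξ i → E d) : Prop where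
  measurable : ∀ i, Measurable fun p : E d × Ξ i => g i p.1 p.2
  square_integrable : ∀ i x, MemLp (g i x) 2 (D i)
  unbiased : ∀ i x, ∫ z, g i x z ∂(D i) = gradient (localCost D l i) x
  bounded_variance : ∃ σg : ℝ, 0 < σg ∧ ∀ i x,
    ∫ z, ‖g i x z - gradient (localCost D l i) x‖ ^ 2 ∂(D i) ≤ σg ^ 2

end Problem

section Network

variable {V : Type*} [Fintype V]

/-- The neighbourhood `N_i` of agent `i` in the undirected graph `G`, including `i` itself. -/
noncomputable def neighborhood (G : SimpleGraph V) (i : V) : Finset V := by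
  classical exact Finset.univ.filter fun j => j = i ∨ G.Adj j i

/-- The communication graph is connected, and the weight matrix `A` is supported exactly on the
neighbourhoods, with weights bounded below there, and doubly stochastic. -/
structure Network (G : SimpleGraph V) (A : Matrix V V ℝ) : Prop where
  connected : G.Connected
  weight_lower : ∃ c : ℝ, 0 < c ∧ ∀ i, ∀ j ∈ neighborhood G i, c < A i j
  weight_zero : ∀ i, ∀ j ∉ neighborhood G i, A i j = 0
  row_sum : A *ᵥ 1 = 1
  col_sum : 1 ᵥ* A = 1

end Network

section Algorithm

variable {V : Type*} [Fintype V] {d : ℕ} {Ξ : V → Type*} {Ω : Type*}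

/-- The gradient-perturbation algorithm: `x_{i,0}` is arbitrary and
`x_{i,k+1} = (1 - β_k) x_{i,k} + β_k ∑_{j ∈ N_i} a_{ij} x_{j,k} - α_k (g_i^k + n_{i,k})`, where
`g_i^k = (1/γ_k) ∑_{l < γ_k} g_i(x_{i,k}, ξ_i^l)` averages the `γ_k` gradients sampled by agent `i`
at iteration `k`, and `n_{i,k}` is the privacy noise. -/
noncomputable def iterate (αs βs : ℕ → ℝ) (γs : ℕ → ℕ) (G : SimpleGraph V) (A : Matrix V V ℝ)
    (g : ∀ i, E d → Ξ i → E d) (x₀ : V → E d) (ξ : ∀ (k : ℕ) (i : V), Fin (γs k) → Ω → Ξ i)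
    (noise : ℕ → V → Ω → E d) : ℕ → V → Ω → E d
  | 0 => fun i _ => x₀ i
  | k + 1 => fun i ω =>
      (1 - βs k) • iterate αs βs γs G A g x₀ ξ noise k i ω
        + βs k • ∑ j ∈ neighborhood G i, A i j • iterate αs βs γs G A g x₀ ξ noise k j ω
        - αs k • ((γs k : ℝ)⁻¹ •
              ∑ l, g i (iterate αs βs γs G A g x₀ ξ noise k i ω) (ξ k i l ω)
            + noise k i ω)

variable [∀ i, MeasurableSpace (Ξ i)] [MeasurableSpace Ω]

/-- The randomness of the algorithm. The samples of agent `i` are independent realizations of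
`D_i`. The noise has Laplace distributed entries with variance `2 σ_k ^ 2` and is independent over
agents, over iterations, and of the samples. The random data of different iterations are
independent. (Samples of different agents in one iteration may be dependent, and so may the entries
of one noise vector.) -/
structure AlgorithmRandomness (P : Measure Ω) (D : ∀ i, Measure (Ξ i)) (γs : ℕ → ℕ) (σ : ℕ → ℝ)
    (ξ : ∀ (k : ℕ) (i : V), Fin (γs k) → Ω → Ξ i) (noise : ℕ → V → Ω → E d) : Prop where
  sample_measurable : ∀ k i l, Measurable (ξ k i l)
  sample_law : ∀ k i l, P.map (ξ k i l) = D i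
  sample_indep : ∀ k i, iIndepFun (ξ k i) P
  noise_measurable : ∀ k i, Measurable (noise k i)
  noise_law : ∀ k i (c : Fin d), P.map (fun ω => noise k i ω c) = laplaceMeasure (σ k)
  noise_indep : ∀ k, iIndepFun (noise k) P
  noise_indep_sample : ∀ k,
    IndepFun (fun ω (i : V) => noise k i ω) (fun ω (i : V) (l : Fin (γs k)) => ξ k i l ω) P
  iteration_indep : iIndepFun (fun (k : ℕ) (ω : Ω) =>
    ((fun (i : V) (l : Fin (γs k)) => ξ k i l ω : ∀ i : V, Fin (γs k) → Ξ i),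
      (fun i : V => noise k i ω : V → E d))) P

end Algorithm

end DPOpt

/-! Everything rests on one Lyapunov function, the sum over agents of `‖x_i - x*‖²`; consensus needs
no separate recursion. In a noiseless step, strong monotonicity gives contraction `1 - aμ`, apart
from the cross terms with the local gradients `∇f_i(x*)`, which need not vanish. Their sum does
vanish, so `x_i - x*` may be replaced there by the deviation from one reference agent. By Young's
inequality and a Poincaré inequality on the graph, this deviation is paid for by the dissipation of
the mixing step, at a cost `a²/b`. This is `Network.exists_descent_bound`.

The sampling error and the privacy noise have mean zero given the past, so they only add `α_k²
(const + const · σ_k²)` in expectation (`integral_iterate_succ_le`). With polynomial steps, the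
perturbation is `O(t^(-(α+p)))` for `t = k + a₂` as soon as `p ≤ α - β` and `p ≤ α - 2η`. A
Chung-type lemma (`exists_bound_of_recursion`) then gives the rate `t^(-p)`; for `α = 1` it also
needs `p < a₁ μ`. The exponents of the theorem meet these constraints, after replacing a negative
one by `0`. -/

namespace DPOpt

/-! ### Mixing on the graph and the deterministic one-step contraction -/

section Consensus

variable {V : Type*} [Fintype V] {F : Type*} [NormedAddCommGroup F]

theorem Network.weight_nonneg {G : SimpleGraph V} {A : Matrix V V ℝ} (h : Network G A) (i j : V) :
    0 ≤ A i j := by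
  obtain ⟨c, hc, hA⟩ := h.weight_lower
  by_cases hj : j ∈ neighborhood G i
  · exact (hc.trans (hA i j hj)).le
  · exact (h.weight_zero i j hj).ge

theorem Network.weight_pos_of_adj {G : SimpleGraph V} {A : Matrix V V ℝ} (h : Network G A)
    {i j : V} (hij : G.Adj i j) : 0 < A i j := by
  obtain ⟨c, hc, hA⟩ := h.weight_lower
  refine hc.trans (hA i j ?_)
  simp [neighborhood, hij.symm]

theorem Network.sum_row {G : SimpleGraph V} {A : Matrix V V ℝ} (h : Network G A) (i : V) :
    ∑ j, A i j = 1 := by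
  simpa [Matrix.mulVec, dotProduct] using congrFun h.row_sum i

theorem Network.sum_col {G : SimpleGraph V} {A : Matrix V V ℝ} (h : Network G A) (j : V) :
    ∑ i, A i j = 1 := by
  simpa [Matrix.vecMul, dotProduct] using congrFun h.col_sum j

/-- The weighted sum of the squared disagreements between agents. -/
noncomputable def disagreement (A : Matrix V V ℝ) (y : V → F) : ℝ :=
  ∑ i, ∑ j, A i j * ‖y i - y j‖ ^ 2

theorem Network.disagreement_nonneg {G : SimpleGraph V} {A : Matrix V V ℝ} (h : Network G A)
    (y : V → F) : 0 ≤ disagreement A y :=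
  Finset.sum_nonneg fun i _ => Finset.sum_nonneg fun j _ =>
    mul_nonneg (h.weight_nonneg i j) (sq_nonneg _)

variable (F) in
/-- A Poincaré inequality on the communication graph. -/
theorem Network.exists_norm_sq_sub_le {G : SimpleGraph V} {A : Matrix V V ℝ}
    (h : Network G A) (i j : V) :
    ∃ C : ℝ, 0 ≤ C ∧ ∀ y : V → F, ‖y i - y j‖ ^ 2 ≤ C * disagreement A y := by
  obtain ⟨p⟩ := h.connected.preconnected i j
  induction p with
  | nil => exact ⟨0, le_rfl, fun y => by simp⟩
  | @cons u v w huv p ih =>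
    obtain ⟨C, hC, ih⟩ := ih
    have hA := h.weight_pos_of_adj huv
    -- The triangle inequality through `v` and `(s + t)² ≤ 2s² + 2t²`: the edge contributes `(A u
    -- v)⁻¹`, the rest of the walk `C`.
    refine ⟨2 * (A u v)⁻¹ + 2 * C, by positivity, fun y => ?_⟩
    have h1 : A u v * ‖y u - y v‖ ^ 2 ≤ disagreement A y :=
      (Finset.single_le_sum (f := fun j => A u j * ‖y u - y j‖ ^ 2)
        (fun j _ => mul_nonneg (h.weight_nonneg u j) (sq_nonneg _)) (Finset.mem_univ v)).trans
      (Finset.single_le_sum (f := fun i => ∑ j, A i j * ‖y i - y j‖ ^ 2)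
        (fun i _ => Finset.sum_nonneg fun j _ => mul_nonneg (h.weight_nonneg i j) (sq_nonneg _))
        (Finset.mem_univ u))
    have h2 : ‖y u - y v‖ ^ 2 ≤ (A u v)⁻¹ * disagreement A y := by
      rw [inv_mul_eq_div, le_div_iff₀ hA]; linarith
    have h3 : ‖y u - y w‖ ≤ ‖y u - y v‖ + ‖y v - y w‖ := norm_sub_le_norm_sub_add_norm_sub _ _ _
    have h4 : ‖y u - y w‖ ^ 2 ≤ (‖y u - y v‖ + ‖y v - y w‖) ^ 2 :=
      pow_le_pow_left₀ (norm_nonneg _) h3 2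
    nlinarith [ih y, sq_nonneg (‖y u - y v‖ - ‖y v - y w‖)]

variable [InnerProductSpace ℝ F]

theorem Network.sum_neighborhood {G : SimpleGraph V} {A : Matrix V V ℝ} (h : Network G A)
    (i : V) (y : V → F) : ∑ j ∈ neighborhood G i, A i j • y j = ∑ j, A i j • y j := by
  refine Finset.sum_subset (Finset.subset_univ _) fun j _ hj => ?_
  rw [h.weight_zero i j hj, zero_smul]

theorem norm_sq_sum_smul_le {ι : Type*} (s : Finset ι) (w : ι → ℝ) (v : ι → F)
    (hw : ∀ i ∈ s, 0 ≤ w i) (hs : ∑ i ∈ s, w i = 1) :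
    ‖∑ i ∈ s, w i • v i‖ ^ 2 ≤ ∑ i ∈ s, w i * ‖v i‖ ^ 2 := by
  have hconv : ConvexOn ℝ Set.univ fun x : F => ‖x‖ ^ 2 :=
    (convexOn_norm convex_univ).pow (fun x _ => norm_nonneg x) 2
  simpa using hconv.map_sum_le hw hs (fun i _ => Set.mem_univ _)

/-- Expanding the squares, row sums handle `‖y i‖²` and column sums `‖y j‖²`, so double
stochasticity suffices and `A` need not be symmetric. This is the dissipation produced by mixing. -/
theorem Network.sum_inner_laplacian {G : SimpleGraph V} {A : Matrix V V ℝ} (h : Network G A)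
    (y : V → F) :
    ∑ i, inner ℝ (y i) (y i - ∑ j, A i j • y j) = disagreement A y / 2 := by
  have h1 : disagreement A y =
      ∑ i, ∑ j, (A i j * ‖y i‖ ^ 2 - 2 * (A i j * inner ℝ (y i) (y j)) + A i j * ‖y j‖ ^ 2) := by
    refine Finset.sum_congr rfl fun i _ => Finset.sum_congr rfl fun j _ => ?_
    rw [norm_sub_sq_real]; ring
  have h2 : ∑ i, ∑ j, A i j * ‖y i‖ ^ 2 = ∑ i, ‖y i‖ ^ 2 := by
    refine Finset.sum_congr rfl fun i _ => ?_
    rw [← Finset.sum_mul, h.sum_row, one_mul]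
  have h3 : ∑ i, ∑ j, A i j * ‖y j‖ ^ 2 = ∑ i, ‖y i‖ ^ 2 := by
    rw [Finset.sum_comm]
    refine Finset.sum_congr rfl fun i _ => ?_
    rw [← Finset.sum_mul, h.sum_col, one_mul]
  rw [h1]
  simp only [Finset.sum_add_distrib, Finset.sum_sub_distrib, h2, h3, inner_sub_right, inner_sum,
    real_inner_smul_right, real_inner_self_eq_norm_sq, ← Finset.mul_sum]
  ring

theorem Network.sum_norm_sq_laplacian_le {G : SimpleGraph V} {A : Matrix V V ℝ}
    (h : Network G A) (y : V → F) :
    ∑ i, ‖y i - ∑ j, A i j • y j‖ ^ 2 ≤ disagreement A y := by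
  refine Finset.sum_le_sum fun i _ => ?_
  have : y i - ∑ j, A i j • y j = ∑ j, A i j • (y i - y j) := by
    simp only [smul_sub, Finset.sum_sub_distrib, ← Finset.sum_smul, h.sum_row, one_smul]
  rw [this]
  exact norm_sq_sum_smul_le _ _ _ (fun j _ => h.weight_nonneg i j) (h.sum_row i)

/-- Young's inequality, from `‖εu + av‖² ≥ 0` divided by `ε`. -/
theorem neg_two_mul_inner_le (u v : F) (a : ℝ) {ε : ℝ} (hε : 0 < ε) :
    -(2 * a * inner ℝ u v) ≤ ε * ‖u‖ ^ 2 + a ^ 2 / ε * ‖v‖ ^ 2 := by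
  have h := sq_nonneg ‖ε • u + a • v‖
  rw [norm_add_sq_real, norm_smul, norm_smul, mul_pow, mul_pow, inner_smul_left, inner_smul_right,
    Real.norm_eq_abs, Real.norm_eq_abs, sq_abs, sq_abs] at h
  simp only [conj_trivial] at h
  have h' : 0 ≤ (ε ^ 2 * ‖u‖ ^ 2 + 2 * (ε * (a * inner ℝ u v)) + a ^ 2 * ‖v‖ ^ 2) / ε :=
    div_nonneg h hε.le
  have : (ε ^ 2 * ‖u‖ ^ 2 + 2 * (ε * (a * inner ℝ u v)) + a ^ 2 * ‖v‖ ^ 2) / ε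
      = ε * ‖u‖ ^ 2 + 2 * a * inner ℝ u v + a ^ 2 / ε * ‖v‖ ^ 2 := by
    field_simp
  linarith

theorem norm_add_sq_le_two_mul (u v : F) : ‖u + v‖ ^ 2 ≤ 2 * ‖u‖ ^ 2 + 2 * ‖v‖ ^ 2 := by
  have := parallelogram_law_with_norm ℝ u v
  nlinarith [sq_nonneg ‖u - v‖]

/-- One noiseless step of the algorithm contracts towards the minimizer, up to a perturbation. -/
theorem Network.exists_descent_bound {G : SimpleGraph V} {A : Matrix V V ℝ}
    (h : Network G A) (φ : V → F → F) {L μ : ℝ} (xs : F)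
    (hL : ∀ i x y, ‖φ i x - φ i y‖ ≤ L * ‖x - y‖)
    (hμ : ∀ i x y, μ * ‖x - y‖ ^ 2 ≤ inner ℝ (φ i x - φ i y) (x - y))
    (hxs : ∑ i, φ i xs = 0) :
    ∃ K : ℝ, 0 ≤ K ∧ ∀ a b : ℝ, 0 ≤ a → 0 < b → b ≤ 1 / 4 → 4 * a * L ^ 2 ≤ μ → ∀ x : V → F,
      ∑ i, ‖(1 - b) • x i + b • ∑ j ∈ neighborhood G i, A i j • x j - a • φ i (x i) - xs‖ ^ 2
        ≤ (1 - a * μ) * ∑ i, ‖x i - xs‖ ^ 2 + K * (a ^ 2 + a ^ 2 / b) := by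
  obtain ⟨o⟩ := h.connected.nonempty
  -- All agents are compared with the reference agent `o`. `T` adds up the Poincaré constants, and
  -- the `+ 1` makes it safe to divide by.
  choose C hC0 hC using fun i => h.exists_norm_sq_sub_le F i o
  set T : ℝ := ∑ i, C i + 1
  have hT : 0 < T := by
    have : 0 ≤ ∑ i, C i := Finset.sum_nonneg fun i _ => hC0 i
    positivity
  set S : ℝ := ∑ i, ‖φ i xs‖ ^ 2
  have hS : 0 ≤ S := Finset.sum_nonneg fun i _ => sq_nonneg _
  refine ⟨4 * S + 2 * T * S, by positivity, fun a b ha hb hb4 haL x => ?_⟩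
  set y : V → F := fun i => x i - xs with hy
  set Δ : V → F := fun i => y i - ∑ j, A i j • y j with hΔ
  set Q := disagreement A y
  have hQ : 0 ≤ Q := h.disagreement_nonneg y
  have hstep : ∀ i, (1 - b) • x i + b • ∑ j ∈ neighborhood G i, A i j • x j - a • φ i (x i) - xs
      = y i - (b • Δ i + a • φ i (x i)) := by
    intro i
    rw [h.sum_neighborhood]
    simp only [hΔ, hy, smul_sub, Finset.sum_sub_distrib, ← Finset.sum_smul, h.sum_row, one_smul,
      sub_smul]
    abel
  -- This Young weight makes the deviations from `o` cost exactly half of the dissipation `b * Q`.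
  have hε : 0 < b / (2 * T) := by positivity
  have hone : ∀ i, ‖y i - (b • Δ i + a • φ i (x i))‖ ^ 2 ≤
      (1 - a * μ) * ‖y i‖ ^ 2 - 2 * b * inner ℝ (y i) (Δ i) + 2 * b ^ 2 * ‖Δ i‖ ^ 2
        + (b / (2 * T) * ‖y i - y o‖ ^ 2 + a ^ 2 / (b / (2 * T)) * ‖φ i xs‖ ^ 2)
        + 4 * a ^ 2 * ‖φ i xs‖ ^ 2 - 2 * a * inner ℝ (y o) (φ i xs) := by
    intro i
    have e1 := norm_add_sq_le_two_mul (b • Δ i) (a • φ i (x i))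
    rw [norm_smul, norm_smul, mul_pow, mul_pow, Real.norm_eq_abs, Real.norm_eq_abs, sq_abs,
      sq_abs] at e1
    have e2 : ‖φ i (x i)‖ ^ 2 ≤ 2 * (L ^ 2 * ‖y i‖ ^ 2) + 2 * ‖φ i xs‖ ^ 2 := by
      have := norm_add_sq_le_two_mul (φ i (x i) - φ i xs) (φ i xs)
      rw [sub_add_cancel] at this
      have h3 : ‖φ i (x i) - φ i xs‖ ^ 2 ≤ (L * ‖y i‖) ^ 2 :=
        pow_le_pow_left₀ (norm_nonneg _) (hL i (x i) xs) 2
      rw [mul_pow] at h3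
      linarith
    have e3 : μ * ‖y i‖ ^ 2 ≤ inner ℝ (y i) (φ i (x i)) - inner ℝ (y i) (φ i xs) := by
      have := hμ i (x i) xs
      rwa [real_inner_comm, inner_sub_right] at this
    have e4 := neg_two_mul_inner_le (y i - y o) (φ i xs) a hε
    rw [inner_sub_left] at e4
    rw [norm_sub_sq_real, inner_add_right, real_inner_smul_right, real_inner_smul_right]
    have e5 : a ^ 2 * ‖φ i (x i)‖ ^ 2 ≤
        a ^ 2 * (2 * (L ^ 2 * ‖y i‖ ^ 2) + 2 * ‖φ i xs‖ ^ 2) :=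
      mul_le_mul_of_nonneg_left e2 (sq_nonneg a)
    have e6 : a * (μ * ‖y i‖ ^ 2) ≤
        a * (inner ℝ (y i) (φ i (x i)) - inner ℝ (y i) (φ i xs)) :=
      mul_le_mul_of_nonneg_left e3 ha
    -- Strong monotonicity yields `2aμ`; half of it absorbs the quadratic gradient term, leaving `1
    -- - aμ`.
    have e7 : 4 * a * L ^ 2 * (a * ‖y i‖ ^ 2) ≤ μ * (a * ‖y i‖ ^ 2) :=
      mul_le_mul_of_nonneg_right haL (by positivity)
    linarith
  have hsum1 : ∑ i, inner ℝ (y i) (Δ i) = Q / 2 := h.sum_inner_laplacian y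
  have hsum2 : ∑ i, ‖Δ i‖ ^ 2 ≤ Q := h.sum_norm_sq_laplacian_le y
  have hsum3 : ∑ i, ‖y i - y o‖ ^ 2 ≤ T * Q := by
    calc ∑ i, ‖y i - y o‖ ^ 2 ≤ ∑ i, C i * Q := Finset.sum_le_sum fun i _ => hC i y
      _ = (∑ i, C i) * Q := by rw [Finset.sum_mul]
      _ ≤ T * Q := mul_le_mul_of_nonneg_right (by simp [T]) hQ
  -- Optimality of `xs` enters here: `y o` is the same for all summands.
  have hsum4 : ∑ i, inner ℝ (y o) (φ i xs) = 0 := by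
    rw [← inner_sum, hxs, inner_zero_right]
  simp only [hstep]
  refine (Finset.sum_le_sum fun i _ => hone i).trans ?_
  simp only [Finset.sum_add_distrib, Finset.sum_sub_distrib, ← Finset.mul_sum, hsum1, hsum4]
  -- The dissipation `-b * Q` is used up by `f1` and by twice `f3`, each at most `b * Q / 2`.
  have f1 : b / (2 * T) * ∑ i, ‖y i - y o‖ ^ 2 ≤ b / 2 * Q := by
    calc b / (2 * T) * ∑ i, ‖y i - y o‖ ^ 2 ≤ b / (2 * T) * (T * Q) :=
          mul_le_mul_of_nonneg_left hsum3 hε.le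
      _ = b / 2 * Q := by field_simp
  have f2 : a ^ 2 / (b / (2 * T)) * S = 2 * T * S * (a ^ 2 / b) := by field_simp
  have f3 : b ^ 2 * ∑ i, ‖Δ i‖ ^ 2 ≤ b * (1 / 4) * Q := by
    calc b ^ 2 * ∑ i, ‖Δ i‖ ^ 2 ≤ b ^ 2 * Q := mul_le_mul_of_nonneg_left hsum2 (sq_nonneg b)
      _ ≤ b * (1 / 4) * Q := by
        refine mul_le_mul_of_nonneg_right ?_ hQ
        rw [sq]; exact mul_le_mul_of_nonneg_left hb4 hb.le
  have f4 : 0 ≤ 4 * S * (a ^ 2 / b) := by positivity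
  have f5 : 0 ≤ 2 * T * S * a ^ 2 := by positivity
  change _ + _ + (_ + a ^ 2 / (b / (2 * T)) * S) + 4 * a ^ 2 * S - _ ≤ _
  rw [f2]
  linarith

end Consensus

/-! ### Existence and strictness of the minimizer -/

section Minimizer

variable {F : Type*} [NormedAddCommGroup F] [InnerProductSpace ℝ F]

/-- A strongly monotone Lipschitz map has a zero. -/
theorem exists_zero_of_strongly_monotone [CompleteSpace F] (Φ : F → F) {L μ : ℝ} (hμ : 0 < μ)
    (hL : ∀ x y, ‖Φ x - Φ y‖ ≤ L * ‖x - y‖)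
    (hmono : ∀ x y, μ * ‖x - y‖ ^ 2 ≤ inner ℝ (Φ x - Φ y) (x - y)) :
    ∃ x, Φ x = 0 := by
  -- The map `x - τ Φ x` has squared Lipschitz constant at most `1 - 2τμ + τ²L² ≤ 1 - τμ`. The `μ ^
  -- 2` in the denominator ensures `τμ ≤ 1` without comparing `μ` and `L`.
  set τ : ℝ := μ / (L ^ 2 + μ ^ 2) with hτ
  have hden : 0 < L ^ 2 + μ ^ 2 := by positivity
  have hτ0 : 0 < τ := by positivity
  have hτL : τ * L ^ 2 ≤ μ := by
    rw [hτ, div_mul_eq_mul_div, div_le_iff₀ hden]; nlinarith [pow_pos hμ 3]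
  have hτμ : τ * μ ≤ 1 := by
    rw [hτ, div_mul_eq_mul_div, div_le_one hden]; nlinarith [sq_nonneg L]
  have hq : 0 ≤ 1 - τ * μ := by linarith
  set K : NNReal := ⟨Real.sqrt (1 - τ * μ), Real.sqrt_nonneg _⟩
  have hcontr : ContractingWith K fun x => x - τ • Φ x := by
    refine ⟨?_, LipschitzWith.of_dist_le_mul fun x y => ?_⟩
    · rw [← NNReal.coe_lt_coe]
      change Real.sqrt (1 - τ * μ) < 1
      rw [Real.sqrt_lt' one_pos]
      nlinarith [mul_pos hτ0 hμ]
    · rw [dist_eq_norm, dist_eq_norm]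
      change _ ≤ Real.sqrt (1 - τ * μ) * _
      refine le_of_sq_le_sq ?_ (by positivity)
      rw [mul_pow, Real.sq_sqrt hq]
      have e : x - τ • Φ x - (y - τ • Φ y) = (x - y) - τ • (Φ x - Φ y) := by
        rw [smul_sub]; abel
      have h2 : ‖Φ x - Φ y‖ ^ 2 ≤ L ^ 2 * ‖x - y‖ ^ 2 := by
        rw [← mul_pow]; exact pow_le_pow_left₀ (norm_nonneg _) (hL x y) 2
      have h3 := hmono x y
      rw [real_inner_comm] at h3
      rw [e, norm_sub_sq_real, real_inner_smul_right, norm_smul, mul_pow, Real.norm_eq_abs, sq_abs]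
      have h4 : τ ^ 2 * ‖Φ x - Φ y‖ ^ 2 ≤ τ * (τ * L ^ 2) * ‖x - y‖ ^ 2 := by
        nlinarith [sq_nonneg τ]
      have h5 : τ * (τ * L ^ 2) * ‖x - y‖ ^ 2 ≤ τ * μ * ‖x - y‖ ^ 2 := by gcongr
      nlinarith
  refine ⟨hcontr.fixedPoint, ?_⟩
  have hfix : hcontr.fixedPoint - τ • Φ hcontr.fixedPoint = hcontr.fixedPoint :=
    hcontr.fixedPoint_isFixedPt
  have : τ • Φ hcontr.fixedPoint = 0 := by simpa using hfix
  exact (smul_eq_zero.1 this).resolve_left hτ0.ne'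

/-- A zero of a strongly monotone gradient is a strict global minimizer. -/
theorem lt_of_gradient_eq_zero [CompleteSpace F] (f : F → ℝ) (Φ : F → F) {μ : ℝ} (hμ : 0 < μ)
    (hf : ∀ x, HasGradientAt f (Φ x) x)
    (hmono : ∀ x y, μ * ‖x - y‖ ^ 2 ≤ inner ℝ (Φ x - Φ y) (x - y))
    {xs : F} (hxs : Φ xs = 0) {y : F} (hy : y ≠ xs) : f xs < f y := by
  have hline : ∀ t : ℝ, HasDerivAt (fun t : ℝ => f (xs + t • (y - xs)))
      (inner ℝ (Φ (xs + t • (y - xs))) (y - xs)) t := by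
    intro t
    have h1 : HasDerivAt (fun t : ℝ => xs + t • (y - xs)) (y - xs) t := by
      simpa using ((hasDerivAt_id t).smul_const (y - xs)).const_add xs
    exact (hf (xs + t • (y - xs))).hasFDerivAt.comp_hasDerivAt t h1
  obtain ⟨t, ht, hslope⟩ := exists_hasDerivAt_eq_slope _ _ (zero_lt_one' ℝ)
    (fun t _ => (hline t).continuousAt.continuousWithinAt) fun t _ => hline t
  -- At the mean value point, monotonicity against the zero `xs` makes the directional derivative
  -- positive.
  have h := hmono (xs + t • (y - xs)) xs
  rw [hxs, sub_zero, add_sub_cancel_left, inner_smul_right, norm_smul, mul_pow] at h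
  have hpos : 0 < ‖y - xs‖ := norm_pos_iff.2 (sub_ne_zero.2 hy)
  have ht0 : 0 < ‖t‖ := norm_pos_iff.2 ht.1.ne'
  have h' : 0 < t * inner ℝ (Φ (xs + t • (y - xs))) (y - xs) := lt_of_lt_of_le (by positivity) h
  have h'' := pos_of_mul_pos_right h' ht.1.le
  rw [hslope] at h''
  simpa using h''

theorem RegularCosts.exists_uniform_lipschitz {V : Type*} [Fintype V] {d : ℕ} {Ξ : V → Type*}
    [∀ i, MeasurableSpace (Ξ i)] {D : ∀ i, Measure (Ξ i)} {l : ∀ i, E d → Ξ i → ℝ} {μ : ℝ}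
    (h : RegularCosts D l μ) : ∃ L : ℝ, 0 < L ∧ ∀ i x y,
      ‖gradient (localCost D l i) x - gradient (localCost D l i) y‖ ≤ L * ‖x - y‖ := by
  choose L hL0 hL using h.lipschitz
  have hnn : 0 ≤ ∑ i, L i := Finset.sum_nonneg fun i _ => (hL0 i).le
  refine ⟨∑ i, L i + 1, by positivity, fun i x y => (hL i x y).trans ?_⟩
  have : L i ≤ ∑ i, L i := Finset.single_le_sum (fun i _ => (hL0 i).le) (Finset.mem_univ i)
  exact mul_le_mul_of_nonneg_right (by linarith) (norm_nonneg _)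

theorem RegularCosts.exists_minimizer {V : Type*} [Fintype V] [Nonempty V] {d : ℕ} {Ξ : V → Type*}
    [∀ i, MeasurableSpace (Ξ i)] {D : ∀ i, Measure (Ξ i)} {l : ∀ i, E d → Ξ i → ℝ} {μ : ℝ}
    (h : RegularCosts D l μ) : ∃ xs : E d, ∑ i, gradient (localCost D l i) xs = 0 ∧
      ∀ y, y ≠ xs → globalCost D l xs < globalCost D l y := by
  obtain ⟨L, hL0, hL⟩ := h.exists_uniform_lipschitz
  have hcard : (0 : ℝ) < Fintype.card V := by exact_mod_cast Fintype.card_pos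
  have hmono : ∀ x y : E d, (Fintype.card V * μ) * ‖x - y‖ ^ 2 ≤
      inner ℝ (∑ i, gradient (localCost D l i) x - ∑ i, gradient (localCost D l i) y) (x - y) := by
    intro x y
    rw [← Finset.sum_sub_distrib, sum_inner]
    calc _ = ∑ _i : V, μ * ‖x - y‖ ^ 2 := by simp [mul_assoc]
      _ ≤ _ := Finset.sum_le_sum fun i _ => h.strongly_convex i x y
  obtain ⟨xs, hxs⟩ := exists_zero_of_strongly_monotone
    (fun x => ∑ i, gradient (localCost D l i) x) (L := Fintype.card V * L)
    (mul_pos hcard h.mu_pos) (fun x y => by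
      rw [← Finset.sum_sub_distrib]
      refine (norm_sum_le _ _).trans ?_
      calc _ ≤ ∑ _i : V, L * ‖x - y‖ := Finset.sum_le_sum fun i _ => hL i x y
        _ = _ := by simp [mul_assoc]) hmono
  refine ⟨xs, hxs, fun y hy => ?_⟩
  refine lt_of_gradient_eq_zero (globalCost D l) (fun x => ∑ i, gradient (localCost D l i) x)
    (mul_pos hcard h.mu_pos) (fun x => ?_) hmono hxs hy
  have := HasFDerivAt.fun_sum (u := Finset.univ) fun i _ =>
    (h.differentiable i x).hasGradientAt.hasFDerivAt
  rw [hasGradientAt_iff_hasFDerivAt, map_sum]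
  exact this

end Minimizer

/-! ### Moments of the Laplace distribution, scalar and vector -/

section Laplace

theorem integrable_comp_abs_of_integrableOn {f : ℝ → ℝ}
    (hf : IntegrableOn (fun x => f x) (Set.Ioi 0)) : Integrable fun x => f |x| := by
  rw [← integrableOn_univ, ← Set.Iic_union_Ioi (a := (0 : ℝ))]
  have hpos : IntegrableOn (fun x => f |x|) (Set.Ioi 0) :=
    hf.congr_fun (fun x hx => by rw [abs_of_pos hx]) measurableSet_Ioi
  refine IntegrableOn.union ?_ hpos
  have := ((integrableOn_Ici_iff_integrableOn_Ioi).2 hpos)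
  have h := ((Measure.measurePreserving_neg (volume : Measure ℝ)).integrableOn_comp_preimage
    (Homeomorph.neg ℝ).measurableEmbedding).2 this
  simpa [Function.comp_def] using h

theorem integrable_pow_mul_laplace {b : ℝ} (hb : 0 < b) (n : ℕ) :
    Integrable fun x : ℝ => |x| ^ n * (Real.exp (-|x| / b) / (2 * b)) := by
  refine integrable_comp_abs_of_integrableOn (f := fun x => x ^ n * (Real.exp (-x / b) / (2 * b))) ?_
  have := (integrableOn_rpow_mul_exp_neg_mul_rpow (p := 1) (s := n) (b := b⁻¹)
    (by linarith [n.cast_nonneg (α := ℝ)]) one_pos (inv_pos.2 hb)).mul_const (2 * b)⁻¹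
  refine this.congr (Eventually.of_forall fun x => ?_)
  simp only [Real.rpow_natCast, Real.rpow_one]
  rw [show -b⁻¹ * x = -x / b by field_simp]
  ring

theorem integrable_laplaceMeasure_iff {b : ℝ} (hb : 0 < b) {g : ℝ → ℝ} :
    Integrable g (laplaceMeasure b) ↔
      Integrable fun x => g x * (Real.exp (-|x| / b) / (2 * b)) := by
  rw [laplaceMeasure, integrable_withDensity_iff (by fun_prop) (by simp)]
  have : ∀ x : ℝ, (ENNReal.ofReal (Real.exp (-|x| / b) / (2 * b))).toReal =
      Real.exp (-|x| / b) / (2 * b) := fun x => ENNReal.toReal_ofReal (by positivity)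
  simp only [this]

theorem integral_laplaceMeasure {b : ℝ} (hb : 0 < b) (g : ℝ → ℝ) :
    ∫ x, g x ∂(laplaceMeasure b) = ∫ x, g x * (Real.exp (-|x| / b) / (2 * b)) := by
  rw [laplaceMeasure, integral_withDensity_eq_integral_toReal_smul (by fun_prop) (by simp)]
  refine integral_congr_ae (Eventually.of_forall fun x => ?_)
  simp only [smul_eq_mul]
  rw [ENNReal.toReal_ofReal (by positivity), mul_comm]

theorem integrable_sq_laplaceMeasure {b : ℝ} (hb : 0 < b) :
    Integrable (fun x => x ^ 2) (laplaceMeasure b) := by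
  rw [integrable_laplaceMeasure_iff hb]
  simpa using integrable_pow_mul_laplace hb 2

theorem integral_sq_laplaceMeasure {b : ℝ} (hb : 0 < b) :
    ∫ x, x ^ 2 ∂(laplaceMeasure b) = 2 * b ^ 2 := by
  rw [integral_laplaceMeasure hb]
  have h := integral_comp_abs (f := fun x => x ^ 2 * (Real.exp (-x / b) / (2 * b)))
  simp only [sq_abs] at h
  rw [h]
  -- By evenness the moment is `2 · b³ Γ(3) / (2b)`.
  have h2 := Real.integral_rpow_mul_exp_neg_mul_Ioi (a := 3) (r := b⁻¹) (by norm_num)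
    (inv_pos.2 hb)
  have h3 : ∫ x in Set.Ioi (0 : ℝ), x ^ 2 * (Real.exp (-x / b) / (2 * b)) =
      (∫ t in Set.Ioi (0 : ℝ), t ^ ((3 : ℝ) - 1) * Real.exp (-(b⁻¹ * t))) * (2 * b)⁻¹ := by
    rw [← integral_mul_const]
    refine integral_congr_ae (Eventually.of_forall fun x => ?_)
    simp only
    rw [show ((3 : ℝ) - 1) = (2 : ℕ) by norm_num, Real.rpow_natCast,
      show -(b⁻¹ * x) = -x / b by field_simp]
    ring
  have hG : Real.Gamma 3 = 2 := by
    rw [show (3 : ℝ) = (2 : ℕ) + 1 by norm_num, Real.Gamma_nat_eq_factorial]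
    rfl
  rw [h3, h2, hG, one_div, inv_inv, show (3 : ℝ) = (3 : ℕ) by norm_num, Real.rpow_natCast]
  field_simp

theorem integral_id_laplaceMeasure {b : ℝ} (hb : 0 < b) : ∫ x, x ∂(laplaceMeasure b) = 0 := by
  rw [integral_laplaceMeasure hb]
  have h := integral_neg_eq_self (fun x : ℝ => x * (Real.exp (-|x| / b) / (2 * b))) volume
  simp only [abs_neg, neg_mul, integral_neg] at h
  linarith

end Laplace

section LaplaceVector

variable {Ω : Type*} [MeasurableSpace Ω] {P : Measure Ω} {d : ℕ}
  {n : Ω → E d} {b : ℝ}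

theorem integrable_sq_apply_of_laplace (hb : 0 < b) (hn : Measurable n)
    (hlaw : ∀ c, P.map (fun ω => n ω c) = laplaceMeasure b) (c : Fin d) :
    Integrable (fun ω => n ω c ^ 2) P := by
  have hc : Measurable fun ω => n ω c := by fun_prop
  have := integrable_sq_laplaceMeasure hb
  rw [← hlaw c] at this
  exact this.comp_measurable hc

theorem memLp_two_of_laplace (hb : 0 < b) (hn : Measurable n)
    (hlaw : ∀ c, P.map (fun ω => n ω c) = laplaceMeasure b) : MemLp n 2 P := by
  rw [memLp_two_iff_integrable_sq_norm hn.aestronglyMeasurable]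
  simp only [EuclideanSpace.norm_sq_eq, Real.norm_eq_abs, sq_abs]
  exact integrable_finsetSum _ fun c _ => integrable_sq_apply_of_laplace hb hn hlaw c

theorem integral_norm_sq_of_laplace (hb : 0 < b) (hn : Measurable n)
    (hlaw : ∀ c, P.map (fun ω => n ω c) = laplaceMeasure b) :
    ∫ ω, ‖n ω‖ ^ 2 ∂P = d * (2 * b ^ 2) := by
  simp only [EuclideanSpace.norm_sq_eq, Real.norm_eq_abs, sq_abs]
  rw [integral_finsetSum _ fun c _ => integrable_sq_apply_of_laplace hb hn hlaw c]
  have : ∀ c, ∫ ω, n ω c ^ 2 ∂P = 2 * b ^ 2 := by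
    intro c
    have hc : Measurable fun ω => n ω c := by fun_prop
    rw [← integral_sq_laplaceMeasure hb, ← hlaw c,
      integral_map hc.aemeasurable (by fun_prop)]
  simp [this]

theorem integral_eq_zero_of_laplace [IsFiniteMeasure P] (hb : 0 < b) (hn : Measurable n)
    (hlaw : ∀ c, P.map (fun ω => n ω c) = laplaceMeasure b) : ∫ ω, n ω ∂P = 0 := by
  have hint : Integrable n P := (memLp_two_of_laplace hb hn hlaw).integrable one_le_two
  ext c
  have h := (EuclideanSpace.proj (𝕜 := ℝ) c).integral_comp_comm hint
  have hc : Measurable fun ω => n ω c := by fun_prop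
  have h2 : ∫ ω, n ω c ∂P = 0 := by
    rw [← integral_id_laplaceMeasure hb, ← hlaw c, integral_map hc.aemeasurable (by fun_prop)]
  exact h.symm.trans h2

end LaplaceVector

/-! ### Functions of a state and an independent fresh sample -/

section FreshSample

variable {Ω S T F : Type*} [MeasurableSpace Ω] [MeasurableSpace S] [MeasurableSpace T]
  [NormedAddCommGroup F] {P : Measure Ω}

theorem integrable_inner_of_memLp [InnerProductSpace ℝ F] {u v : Ω → F} (hu : MemLp u 2 P)
    (hv : MemLp v 2 P) : Integrable (fun ω => inner ℝ (u ω) (v ω)) P :=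
  (hu.norm.integrable_mul hv.norm).mono (hu.1.inner hv.1) (Eventually.of_forall fun ω => by
    simpa using abs_real_inner_le_norm (u ω) (v ω))

variable [IsProbabilityMeasure P] [MeasurableSpace F] [BorelSpace F]
  [SecondCountableTopology F] {X : Ω → S} {Z : Ω → T} {D : Measure T} {h : S → T → F}

theorem map_prodMk_eq_prod (hX : Measurable X) (hZ : Measurable Z) (hXZ : IndepFun X Z P)
    (hD : P.map Z = D) : P.map (fun ω => (X ω, Z ω)) = (P.map X).prod D := by
  rw [(indepFun_iff_map_prod_eq_prod_map_map hX.aemeasurable hZ.aemeasurable).1 hXZ, hD]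

/-- Fubini under the product law. Since `B` is uniform in the frozen state, no moment of `X` is
needed. -/
theorem memLp_two_fresh (hX : Measurable X) (hZ : Measurable Z) (hXZ : IndepFun X Z P)
    (hD : P.map Z = D) (hh : Measurable fun p : S × T => h p.1 p.2)
    (h2 : ∀ x, MemLp (h x) 2 D) {B : ℝ} (hB : ∀ x, ∫ z, ‖h x z‖ ^ 2 ∂D ≤ B) :
    MemLp (fun ω => h (X ω) (Z ω)) 2 P ∧ ∫ ω, ‖h (X ω) (Z ω)‖ ^ 2 ∂P ≤ B := by
  have := Measure.isProbabilityMeasure_map (μ := P) hX.aemeasurable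
  have : IsProbabilityMeasure D := hD ▸ Measure.isProbabilityMeasure_map hZ.aemeasurable
  have hXZm : Measurable fun ω => (X ω, Z ω) := hX.prodMk hZ
  have hmap := map_prodMk_eq_prod hX hZ hXZ hD
  have hsq : Measurable fun p : S × T => ‖h p.1 p.2‖ ^ 2 := hh.norm.pow_const 2
  have hint : Integrable (fun p : S × T => ‖h p.1 p.2‖ ^ 2) ((P.map X).prod D) := by
    rw [integrable_prod_iff hsq.aestronglyMeasurable]
    refine ⟨Eventually.of_forall fun x => ?_, ?_⟩
    · exact (memLp_two_iff_integrable_sq_norm (h2 x).1).1 (h2 x)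
    · simp only [norm_pow, norm_norm]
      refine Integrable.of_bound
        (hsq.stronglyMeasurable.integral_prod_right').aestronglyMeasurable B
        (Eventually.of_forall fun x => ?_)
      rw [Real.norm_of_nonneg (integral_nonneg fun z => sq_nonneg _)]
      exact hB x
  have hm : Measurable fun ω => h (X ω) (Z ω) := hh.comp hXZm
  refine ⟨?_, ?_⟩
  · rw [memLp_two_iff_integrable_sq_norm hm.aestronglyMeasurable]
    rw [← hmap] at hint
    exact hint.comp_measurable hXZm
  · calc ∫ ω, ‖h (X ω) (Z ω)‖ ^ 2 ∂P
        = ∫ p, ‖h p.1 p.2‖ ^ 2 ∂(P.map fun ω => (X ω, Z ω)) :=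
          (integral_map hXZm.aemeasurable hsq.aestronglyMeasurable).symm
      _ = ∫ x, ∫ z, ‖h x z‖ ^ 2 ∂D ∂(P.map X) := by rw [hmap, integral_prod _ hint]
      _ ≤ ∫ _x, B ∂(P.map X) :=
          integral_mono hint.integral_prod_left (integrable_const B) hB
      _ = B := by simp

/-- Freezing the state by Fubini replaces conditional expectations: the inner integral is `⟨u x,
0⟩`. -/
theorem integral_inner_fresh_eq_zero [InnerProductSpace ℝ F] [CompleteSpace F]
    (hX : Measurable X) (hZ : Measurable Z) (hXZ : IndepFun X Z P)
    (hD : P.map Z = D) (hh : Measurable fun p : S × T => h p.1 p.2)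
    (h2 : ∀ x, MemLp (h x) 2 D) {B : ℝ} (hB : ∀ x, ∫ z, ‖h x z‖ ^ 2 ∂D ≤ B)
    (h0 : ∀ x, ∫ z, h x z ∂D = 0) {u : S → F} (hu : Measurable u)
    (hu2 : MemLp (fun ω => u (X ω)) 2 P) :
    ∫ ω, inner ℝ (u (X ω)) (h (X ω) (Z ω)) ∂P = 0 := by
  have := Measure.isProbabilityMeasure_map (μ := P) hX.aemeasurable
  have : IsProbabilityMeasure D := hD ▸ Measure.isProbabilityMeasure_map hZ.aemeasurable
  have hXZm : Measurable fun ω => (X ω, Z ω) := hX.prodMk hZ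
  have hmap := map_prodMk_eq_prod hX hZ hXZ hD
  have hmeas : Measurable fun p : S × T => inner ℝ (u p.1) (h p.1 p.2) :=
    (hu.comp measurable_fst).inner hh
  have hint : Integrable (fun p : S × T => inner ℝ (u p.1) (h p.1 p.2)) ((P.map X).prod D) := by
    rw [← hmap, integrable_map_measure hmeas.aestronglyMeasurable hXZm.aemeasurable]
    exact integrable_inner_of_memLp hu2 (memLp_two_fresh hX hZ hXZ hD hh h2 hB).1
  calc ∫ ω, inner ℝ (u (X ω)) (h (X ω) (Z ω)) ∂P
      = ∫ p, inner ℝ (u p.1) (h p.1 p.2) ∂(P.map fun ω => (X ω, Z ω)) :=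
        (integral_map hXZm.aemeasurable hmeas.aestronglyMeasurable).symm
    _ = ∫ x, ∫ z, inner ℝ (u x) (h x z) ∂D ∂(P.map X) := by rw [hmap, integral_prod _ hint]
    _ = ∫ _x, (0 : ℝ) ∂(P.map X) := by
        refine integral_congr_ae (Eventually.of_forall fun x => ?_)
        simp only
        rw [integral_inner ((h2 x).integrable one_le_two), h0, inner_zero_right]
    _ = 0 := by simp

end FreshSample

/-! ### Adaptedness of the iterates and independence from the current round -/

section History

variable {V : Type*} {d : ℕ} {Ξ : V → Type*} {Ω : Type*}
  [∀ i, MeasurableSpace (Ξ i)]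
  {αs βs : ℕ → ℝ} {γs : ℕ → ℕ} {G : SimpleGraph V} {A : Matrix V V ℝ}
  {g : ∀ i, E d → Ξ i → E d} {x₀ : V → E d} {ξ : ∀ (k : ℕ) (i : V), Fin (γs k) → Ω → Ξ i}
  {noise : ℕ → V → Ω → E d}

variable (ξ noise) in
/-- The samples and the noise of one iteration. -/
def roundData (k : ℕ) (ω : Ω) : (∀ i : V, Fin (γs k) → Ξ i) × (V → E d) :=
  (fun i l => ξ k i l ω, fun i => noise k i ω)

variable (ξ noise) in
/-- The `σ`-algebra generated by the random data of the iterations before `k`. -/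
abbrev history (k : ℕ) : MeasurableSpace Ω :=
  ⨆ j ∈ Set.Iio k, MeasurableSpace.comap (roundData ξ noise j) inferInstance

theorem history_mono {j k : ℕ} (hjk : j ≤ k) : history ξ noise j ≤ history ξ noise k :=
  biSup_mono fun _ hi => lt_of_lt_of_le hi hjk

theorem measurable_roundData_history (k : ℕ) :
    Measurable[history ξ noise (k + 1)] (roundData ξ noise k) := by
  refine Measurable.mono (comap_measurable (roundData ξ noise k)) ?_ le_rfl
  exact le_biSup (fun j => MeasurableSpace.comap (roundData ξ noise j) inferInstance)
    (Set.mem_Iio.2 k.lt_succ_self)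

theorem AlgorithmRandomness.measurable_roundData [MeasurableSpace Ω] {P : Measure Ω}
    {D : ∀ i, Measure (Ξ i)} {σ : ℕ → ℝ}
    (h : AlgorithmRandomness P D γs σ ξ noise) (k : ℕ) : Measurable (roundData ξ noise k) :=
  (measurable_pi_lambda _ fun i => measurable_pi_lambda _ fun l =>
    h.sample_measurable k i l).prodMk (measurable_pi_lambda _ fun i => h.noise_measurable k i)

theorem AlgorithmRandomness.history_le [MeasurableSpace Ω] {P : Measure Ω}
    {D : ∀ i, Measure (Ξ i)} {σ : ℕ → ℝ}
    (h : AlgorithmRandomness P D γs σ ξ noise) (k : ℕ) :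
    history ξ noise k ≤ ‹MeasurableSpace Ω› :=
  iSup₂_le fun j _ => (h.measurable_roundData j).comap_le

variable [Fintype V]

/-- The σ-algebra on `Ω` is left free so that it can be taken to be `history`. -/
theorem measurable_iterate_succ [MeasurableSpace Ω]
    (hg : ∀ i, Measurable fun p : E d × Ξ i => g i p.1 p.2) {k : ℕ}
    (hx : ∀ i, Measurable (iterate αs βs γs G A g x₀ ξ noise k i))
    (hξ : ∀ i l, Measurable (ξ k i l)) (hn : ∀ i, Measurable (noise k i)) (i : V) :
    Measurable (iterate αs βs γs G A g x₀ ξ noise (k + 1) i) := by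
  have h1 : ∀ l, Measurable fun ω =>
      g i (iterate αs βs γs G A g x₀ ξ noise k i ω) (ξ k i l ω) := fun l =>
    (hg i).comp ((hx i).prodMk (hξ i l))
  have h2 := hn i
  unfold iterate
  fun_prop

theorem measurable_iterate_history (hg : ∀ i, Measurable fun p : E d × Ξ i => g i p.1 p.2)
    (k : ℕ) (i : V) :
    Measurable[history ξ noise k] (iterate αs βs γs G A g x₀ ξ noise k i) := by
  induction k generalizing i with
  | zero => exact measurable_const
  | succ k ih =>
    have hr : Measurable[history ξ noise (k + 1)] (roundData ξ noise k) :=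
      measurable_roundData_history k
    refine @measurable_iterate_succ V d Ξ Ω _ αs βs γs G A g x₀ ξ noise _
      (history ξ noise (k + 1)) hg k (fun j => (ih j).mono (history_mono k.le_succ) le_rfl)
      (fun j l => ?_) (fun j => ?_) i
    · exact (measurable_pi_apply l).comp ((measurable_pi_apply j).comp (measurable_fst.comp hr))
    · exact (measurable_pi_apply j).comp (measurable_snd.comp hr)

variable [MeasurableSpace Ω] {P : Measure Ω} {D : ∀ i, Measure (Ξ i)} {σ : ℕ → ℝ}

theorem AlgorithmRandomness.measurable_iterate (h : AlgorithmRandomness P D γs σ ξ noise)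
    (hg : ∀ i, Measurable fun p : E d × Ξ i => g i p.1 p.2) (k : ℕ) (i : V) :
    Measurable (iterate αs βs γs G A g x₀ ξ noise k i) :=
  (measurable_iterate_history hg k i).mono (h.history_le k) le_rfl

/-- The state at `k` is a function of the rounds in `Set.Iio k`, a set of indices disjoint from
`{k}`. -/
theorem AlgorithmRandomness.indepFun_iterate_roundData
    (h : AlgorithmRandomness P D γs σ ξ noise)
    (hg : ∀ i, Measurable fun p : E d × Ξ i => g i p.1 p.2) (k : ℕ) :
    IndepFun (fun ω i => iterate αs βs γs G A g x₀ ξ noise k i ω) (roundData ξ noise k) P := by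
  have hind : iIndepFun (roundData ξ noise) P := h.iteration_indep
  have h1 := indep_iSup_of_disjoint (fun j => (h.measurable_roundData j).comap_le) hind.iIndep
    (S := Set.Iio k) (T := {k}) (by simp)
  rw [iSup_singleton] at h1
  refine (IndepFun_iff_Indep _ _ _).2 (indep_of_indep_of_le_left h1 ?_)
  have : Measurable[history ξ noise k] fun ω i => iterate αs βs γs G A g x₀ ξ noise k i ω :=
    @measurable_pi_lambda _ _ _ (history ξ noise k) _ _ fun i => measurable_iterate_history hg k i
  exact this.comap_le

theorem AlgorithmRandomness.indepFun_iterate_sample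
    (h : AlgorithmRandomness P D γs σ ξ noise)
    (hg : ∀ i, Measurable fun p : E d × Ξ i => g i p.1 p.2) (k : ℕ) (i : V) (l : Fin (γs k)) :
    IndepFun (fun ω i => iterate αs βs γs G A g x₀ ξ noise k i ω) (ξ k i l) P :=
  (h.indepFun_iterate_roundData hg k).comp measurable_id
    ((measurable_pi_apply l).comp ((measurable_pi_apply i).comp measurable_fst))

theorem AlgorithmRandomness.indepFun_iterate_noise
    (h : AlgorithmRandomness P D γs σ ξ noise)
    (hg : ∀ i, Measurable fun p : E d × Ξ i => g i p.1 p.2) (k : ℕ) (i : V) :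
    IndepFun (fun ω i => iterate αs βs γs G A g x₀ ξ noise k i ω) (noise k i) P :=
  (h.indepFun_iterate_roundData hg k).comp measurable_id
    ((measurable_pi_apply i).comp measurable_snd)

end History

/-! ### From the noiseless step to the mean squared error -/

section ExpectedDescent

variable {V : Type*} {d : ℕ} {Ξ : V → Type*} {Ω : Type*}
  [∀ i, MeasurableSpace (Ξ i)]
  {αs βs : ℕ → ℝ} {γs : ℕ → ℕ} {G : SimpleGraph V} {A : Matrix V V ℝ}
  {l : ∀ i, E d → Ξ i → ℝ} {μ : ℝ}
  {g : ∀ i, E d → Ξ i → E d} {x₀ : V → E d} {ξ : ∀ (k : ℕ) (i : V), Fin (γs k) → Ω → Ξ i}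
  {noise : ℕ → V → Ω → E d} {D : ∀ i, Measure (Ξ i)} {σ : ℕ → ℝ}

theorem RegularCosts.continuous_gradient (h : RegularCosts D l μ) (i : V) :
    Continuous (gradient (localCost D l i)) := by
  obtain ⟨L, hL0, hL⟩ := h.lipschitz i
  refine (LipschitzWith.of_dist_le_mul (K := ⟨L, hL0.le⟩) fun x y => ?_).continuous
  rw [dist_eq_norm, dist_eq_norm]
  exact hL x y

theorem UnbiasedOracle.exists_error_bound (h : UnbiasedOracle D l g) :
    ∃ B : ℝ, 0 ≤ B ∧ ∀ i x, ∫ z, ‖g i x z - gradient (localCost D l i) x‖ ^ 2 ∂(D i) ≤ B := by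
  obtain ⟨s, hs, h⟩ := h.bounded_variance
  exact ⟨s ^ 2, sq_nonneg s, h⟩

theorem UnbiasedOracle.memLp_error [∀ i, IsProbabilityMeasure (D i)]
    (h : UnbiasedOracle D l g) (i : V) (x : E d) :
    MemLp (fun z => g i x z - gradient (localCost D l i) x) 2 (D i) :=
  (h.square_integrable i x).sub (memLp_const _)

theorem UnbiasedOracle.integral_error [∀ i, IsProbabilityMeasure (D i)]
    (h : UnbiasedOracle D l g) (i : V) (x : E d) :
    ∫ z, (g i x z - gradient (localCost D l i) x) ∂(D i) = 0 := by
  rw [integral_sub ((h.square_integrable i x).integrable one_le_two) (integrable_const _),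
    h.unbiased]
  simp

/-- The total noise of one agent in one iteration: the error of the averaged sampled gradients
plus the privacy noise. -/
noncomputable def stepNoise (D : ∀ i, Measure (Ξ i)) (l : ∀ i, E d → Ξ i → ℝ)
    (g : ∀ i, E d → Ξ i → E d) {n : ℕ} {i : V} (z : Fin n → Ω → Ξ i) (v : Ω → E d)
    (X : Ω → E d) (ω : Ω) : E d :=
  (n : ℝ)⁻¹ • ∑ s, (g i (X ω) (z s ω) - gradient (localCost D l i) (X ω)) + v ω

section Step

variable [Fintype V]

/-- A nonempty batch is essential: only then does the true gradient average to itself and leave a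
centred error. -/
theorem iterate_succ_sub {k : ℕ} (hγ : 0 < γs k) (i : V) (ω : Ω) (xs : E d) :
    iterate αs βs γs G A g x₀ ξ noise (k + 1) i ω - xs =
      ((1 - βs k) • iterate αs βs γs G A g x₀ ξ noise k i ω
        + βs k • ∑ j ∈ neighborhood G i, A i j • iterate αs βs γs G A g x₀ ξ noise k j ω
        - αs k • gradient (localCost D l i) (iterate αs βs γs G A g x₀ ξ noise k i ω) - xs)
      - αs k • stepNoise D l g (ξ k i) (noise k i)
          (fun ω => iterate αs βs γs G A g x₀ ξ noise k i ω) ω := by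
  have hγ' : (γs k : ℝ) ≠ 0 := by exact_mod_cast hγ.ne'
  rw [iterate, stepNoise, Finset.sum_sub_distrib, Finset.sum_const, Finset.card_univ,
    Fintype.card_fin, ← Nat.cast_smul_eq_nsmul ℝ, smul_sub, smul_smul, inv_mul_cancel₀ hγ',
    one_smul]
  simp only [smul_add, smul_sub]
  abel

end Step

variable [MeasurableSpace Ω] {P : Measure Ω}

theorem RegularCosts.memLp_gradient [IsFiniteMeasure P] (h : RegularCosts D l μ) (i : V)
    {X : Ω → E d} (hX : MemLp X 2 P) :
    MemLp (fun ω => gradient (localCost D l i) (X ω)) 2 P := by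
  obtain ⟨L, hL0, hL⟩ := h.lipschitz i
  have hbd : MemLp (fun ω => L * ‖X ω‖ + ‖gradient (localCost D l i) 0‖) 2 P :=
    (hX.norm.const_mul L).add (memLp_const _)
  refine hbd.of_le ((h.continuous_gradient i).comp_aestronglyMeasurable hX.1)
    (Eventually.of_forall fun ω => ?_)
  have h1 := hL (X ω) 0
  rw [sub_zero] at h1
  have h2 := norm_le_norm_sub_add (gradient (localCost D l i) (X ω)) (gradient (localCost D l i) 0)
  rw [Real.norm_of_nonneg (by positivity)]
  linarith

/-- The state `X` collects all agents, because the noiseless step `u` of one agent involves its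
neighbours. Convexity of the squared norm bounds the averaged error by `B`, whatever the batch size.
-/
theorem stepNoise_properties [IsProbabilityMeasure P] [∀ i, IsProbabilityMeasure (D i)]
    (hcost : RegularCosts D l μ) (horacle : UnbiasedOracle D l g)
    {B : ℝ} (hB : ∀ i x, ∫ z, ‖g i x z - gradient (localCost D l i) x‖ ^ 2 ∂(D i) ≤ B)
    {n : ℕ} (hn : 0 < n) {i : V} {z : Fin n → Ω → Ξ i} {v : Ω → E d} {X : Ω → V → E d} {b : ℝ}
    (hb : 0 < b) (hX : Measurable X) (hz : ∀ s, Measurable (z s)) (hv : Measurable v)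
    (hzlaw : ∀ s, P.map (z s) = D i) (hvlaw : ∀ c, P.map (fun ω => v ω c) = laplaceMeasure b)
    (hXz : ∀ s, IndepFun X (z s) P) (hXv : IndepFun X v P) :
    MemLp (stepNoise D l g z v fun ω => X ω i) 2 P ∧
    ∫ ω, ‖stepNoise D l g z v (fun ω => X ω i) ω‖ ^ 2 ∂P ≤ 2 * B + 2 * (d * (2 * b ^ 2)) ∧
    ∀ u : (V → E d) → E d, Measurable u → MemLp (fun ω => u (X ω)) 2 P →
      ∫ ω, inner ℝ (u (X ω)) (stepNoise D l g z v (fun ω => X ω i) ω) ∂P = 0 := by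
  set h : (V → E d) → Ξ i → E d := fun x z => g i (x i) z - gradient (localCost D l i) (x i)
  have hh : Measurable fun p : (V → E d) × Ξ i => h p.1 p.2 := by
    have h1 : Measurable fun p : (V → E d) × Ξ i => p.1 i :=
      (measurable_pi_apply i).comp measurable_fst
    exact ((horacle.measurable i).comp (h1.prodMk measurable_snd)).sub
      ((hcost.continuous_gradient i).measurable.comp h1)
  have h2 : ∀ x, MemLp (h x) 2 (D i) := fun x => horacle.memLp_error i (x i)
  have hhB : ∀ x, ∫ z, ‖h x z‖ ^ 2 ∂(D i) ≤ B := fun x => hB i (x i)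
  have hs := fun s => memLp_two_fresh hX (hz s) (hXz s) (hzlaw s) hh h2 hhB
  have hv2 : MemLp v 2 P := memLp_two_of_laplace hb hv hvlaw
  have hn' : (0 : ℝ) < n := by exact_mod_cast hn
  have hL2 : MemLp (stepNoise D l g z v fun ω => X ω i) 2 P :=
    ((memLp_finsetSum Finset.univ fun s _ => (hs s).1).const_smul (n : ℝ)⁻¹).add hv2
  refine ⟨hL2, ?_, fun u hu hu2 => ?_⟩
  · have hsint : ∀ s, Integrable (fun ω => ‖h (X ω) (z s ω)‖ ^ 2) P := fun s =>
      (memLp_two_iff_integrable_sq_norm (hs s).1.1).1 (hs s).1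
    have hvint : Integrable (fun ω => ‖v ω‖ ^ 2) P :=
      (memLp_two_iff_integrable_sq_norm hv2.1).1 hv2
    have hpt : ∀ ω, ‖stepNoise D l g z v (fun ω => X ω i) ω‖ ^ 2 ≤
        2 * ∑ s, (n : ℝ)⁻¹ * ‖h (X ω) (z s ω)‖ ^ 2 + 2 * ‖v ω‖ ^ 2 := by
      intro ω
      have e1 := norm_add_sq_le_two_mul ((n : ℝ)⁻¹ • ∑ s, h (X ω) (z s ω)) (v ω)
      have e2 := norm_sq_sum_smul_le Finset.univ (fun _ => (n : ℝ)⁻¹)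
        (fun s => h (X ω) (z s ω)) (fun _ _ => (inv_pos.2 hn').le)
        (by simp [hn'.ne'])
      rw [← Finset.smul_sum] at e2
      exact e1.trans (by linarith)
    have hI1 : Integrable (fun ω => ∑ s, (n : ℝ)⁻¹ * ‖h (X ω) (z s ω)‖ ^ 2) P :=
      integrable_finsetSum _ fun s _ => (hsint s).const_mul _
    calc ∫ ω, ‖stepNoise D l g z v (fun ω => X ω i) ω‖ ^ 2 ∂P
        ≤ ∫ ω, (2 * ∑ s, (n : ℝ)⁻¹ * ‖h (X ω) (z s ω)‖ ^ 2 + 2 * ‖v ω‖ ^ 2) ∂P :=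
          integral_mono ((memLp_two_iff_integrable_sq_norm hL2.1).1 hL2)
            ((hI1.const_mul 2).add (hvint.const_mul 2)) hpt
      _ = 2 * ∑ s, (n : ℝ)⁻¹ * ∫ ω, ‖h (X ω) (z s ω)‖ ^ 2 ∂P + 2 * (d * (2 * b ^ 2)) := by
          rw [integral_add (hI1.const_mul 2) (hvint.const_mul 2), integral_const_mul,
            integral_const_mul, integral_finsetSum _ fun s _ => (hsint s).const_mul _,
            integral_norm_sq_of_laplace hb hv hvlaw]
          simp only [integral_const_mul]
      _ ≤ 2 * ∑ _s : Fin n, (n : ℝ)⁻¹ * B + 2 * (d * (2 * b ^ 2)) := by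
          gcongr with s _
          exact (hs s).2
      _ = 2 * B + 2 * (d * (2 * b ^ 2)) := by
          simp [mul_inv_cancel_left₀ hn'.ne']
  · have hsint : ∀ s, Integrable (fun ω => inner ℝ (u (X ω)) (h (X ω) (z s ω))) P := fun s =>
      integrable_inner_of_memLp hu2 (hs s).1
    have hv0 : ∫ ω, inner ℝ (u (X ω)) (v ω) ∂P = 0 := by
      have hid : MemLp (fun y : E d => y) 2 (P.map v) := by
        rw [memLp_map_measure_iff measurable_id'.aestronglyMeasurable hv.aemeasurable]
        exact hv2
      -- The privacy noise is a fresh sample that ignores the state, and its own second moment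
      -- serves as the bound.
      refine integral_inner_fresh_eq_zero (h := fun _ y => y) hX hv hXv rfl measurable_snd
        (fun _ => hid) (fun _ => le_rfl) (fun _ => ?_) hu hu2
      rw [integral_map hv.aemeasurable measurable_id'.aestronglyMeasurable]
      exact integral_eq_zero_of_laplace hb hv hvlaw
    have hexp : ∀ ω, inner ℝ (u (X ω)) (stepNoise D l g z v (fun ω => X ω i) ω) =
        (n : ℝ)⁻¹ * ∑ s, inner ℝ (u (X ω)) (h (X ω) (z s ω)) + inner ℝ (u (X ω)) (v ω) := by
      intro ω
      rw [stepNoise, inner_add_right, real_inner_smul_right, inner_sum]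
    simp only [hexp]
    rw [integral_add ((integrable_finsetSum _ fun s _ => hsint s).const_mul _)
      (integrable_inner_of_memLp hu2 hv2), integral_const_mul, hv0,
      integral_finsetSum _ fun s _ => hsint s]
    have : ∀ s, ∫ ω, inner ℝ (u (X ω)) (h (X ω) (z s ω)) ∂P = 0 := fun s =>
      integral_inner_fresh_eq_zero hX (hz s) (hXz s) (hzlaw s) hh h2 hhB
        (fun x => horacle.integral_error i (x i)) hu hu2
    simp [this]

variable [Fintype V]

theorem memLp_noiseless_step [IsFiniteMeasure P] (hcost : RegularCosts D l μ) {X : V → Ω → E d}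
    (hX : ∀ i, MemLp (X i) 2 P) (a b : ℝ) (xs : E d) (i : V) :
    MemLp (fun ω => (1 - b) • X i ω + b • ∑ j ∈ neighborhood G i, A i j • X j ω
      - a • gradient (localCost D l i) (X i ω) - xs) 2 P :=
  ((((hX i).const_smul (1 - b)).add
    ((memLp_finsetSum _ fun j _ => (hX j).const_smul (A i j)).const_smul b)).sub
      ((hcost.memLp_gradient i (hX i)).const_smul a)).sub (memLp_const _)

variable [IsProbabilityMeasure P] [∀ i, IsProbabilityMeasure (D i)]

theorem stepNoise_iterate_properties (hcost : RegularCosts D l μ)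
    (horacle : UnbiasedOracle D l g) (hrand : AlgorithmRandomness P D γs σ ξ noise)
    (hσ : ∀ k, 0 < σ k) (hγ : ∀ k, 0 < γs k)
    {B : ℝ} (hB : ∀ i x, ∫ z, ‖g i x z - gradient (localCost D l i) x‖ ^ 2 ∂(D i) ≤ B)
    (k : ℕ) (i : V) :
    MemLp (stepNoise D l g (ξ k i) (noise k i)
      fun ω => iterate αs βs γs G A g x₀ ξ noise k i ω) 2 P ∧
    ∫ ω, ‖stepNoise D l g (ξ k i) (noise k i)
      (fun ω => iterate αs βs γs G A g x₀ ξ noise k i ω) ω‖ ^ 2 ∂P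
        ≤ 2 * B + 2 * (d * (2 * σ k ^ 2)) ∧
    ∀ u : (V → E d) → E d, Measurable u →
      MemLp (fun ω => u fun j => iterate αs βs γs G A g x₀ ξ noise k j ω) 2 P →
      ∫ ω, inner ℝ (u fun j => iterate αs βs γs G A g x₀ ξ noise k j ω)
        (stepNoise D l g (ξ k i) (noise k i)
          (fun ω => iterate αs βs γs G A g x₀ ξ noise k i ω) ω) ∂P = 0 :=
  stepNoise_properties (X := fun ω j => iterate αs βs γs G A g x₀ ξ noise k j ω)
    hcost horacle hB (hγ k) (hσ k)
    (measurable_pi_lambda _ fun j => hrand.measurable_iterate horacle.measurable k j)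
    (hrand.sample_measurable k i) (hrand.noise_measurable k i) (hrand.sample_law k i)
    (hrand.noise_law k i) (hrand.indepFun_iterate_sample horacle.measurable k i)
    (hrand.indepFun_iterate_noise horacle.measurable k i)

theorem memLp_iterate (hcost : RegularCosts D l μ)
    (horacle : UnbiasedOracle D l g) (hrand : AlgorithmRandomness P D γs σ ξ noise)
    (hσ : ∀ k, 0 < σ k) (hγ : ∀ k, 0 < γs k) (k : ℕ) (i : V) :
    MemLp (iterate αs βs γs G A g x₀ ξ noise k i) 2 P := by
  obtain ⟨B, -, hB⟩ := horacle.exists_error_bound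
  induction k generalizing i with
  | zero => exact memLp_const _
  | succ k ih =>
    have h1 := (memLp_noiseless_step (G := G) (A := A) hcost ih (αs k) (βs k) 0 i).sub
      ((stepNoise_iterate_properties (αs := αs) (βs := βs) (G := G) (A := A) (x₀ := x₀)
        hcost horacle hrand hσ hγ hB k i).1.const_smul (αs k))
    refine h1.ae_eq (Eventually.of_forall fun ω => ?_)
    have := iterate_succ_sub (αs := αs) (βs := βs) (G := G) (A := A) (g := g) (x₀ := x₀) (ξ := ξ)
      (noise := noise) (D := D) (l := l) (hγ k) i ω 0
    rw [sub_zero] at this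
    exact this.symm

/-- A bound on a noiseless step yields a bound on the mean squared error of one iteration. -/
theorem integral_iterate_succ_le (hcost : RegularCosts D l μ)
    (horacle : UnbiasedOracle D l g) (hrand : AlgorithmRandomness P D γs σ ξ noise)
    (hσ : ∀ k, 0 < σ k) (hγ : ∀ k, 0 < γs k)
    {B : ℝ} (hB : ∀ i x, ∫ z, ‖g i x z - gradient (localCost D l i) x‖ ^ 2 ∂(D i) ≤ B)
    (xs : E d) (k : ℕ) {ρ R : ℝ}
    (hdet : ∀ x : V → E d,
      ∑ i, ‖(1 - βs k) • x i + βs k • ∑ j ∈ neighborhood G i, A i j • x j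
        - αs k • gradient (localCost D l i) (x i) - xs‖ ^ 2 ≤ ρ * ∑ i, ‖x i - xs‖ ^ 2 + R) :
    ∑ i, ∫ ω, ‖iterate αs βs γs G A g x₀ ξ noise (k + 1) i ω - xs‖ ^ 2 ∂P ≤
      ρ * ∑ i, ∫ ω, ‖iterate αs βs γs G A g x₀ ξ noise k i ω - xs‖ ^ 2 ∂P + R
        + αs k ^ 2 * (Fintype.card V * (2 * B + 2 * (d * (2 * σ k ^ 2)))) := by
  have hX2 : ∀ i, MemLp (iterate αs βs γs G A g x₀ ξ noise k i) 2 P :=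
    memLp_iterate hcost horacle hrand hσ hγ k
  set X : V → Ω → E d := iterate αs βs γs G A g x₀ ξ noise k with hXdef
  set u : V → (V → E d) → E d := fun i x =>
    (1 - βs k) • x i + βs k • ∑ j ∈ neighborhood G i, A i j • x j
      - αs k • gradient (localCost D l i) (x i) - xs
  set w : V → Ω → E d := fun i => stepNoise D l g (ξ k i) (noise k i) (X i)
  have hu : ∀ i, Measurable (u i) := by
    intro i
    have := (hcost.continuous_gradient i).measurable
    fun_prop
  have hu2 : ∀ i, MemLp (fun ω => u i fun j => X j ω) 2 P := fun i =>
    memLp_noiseless_step hcost hX2 (αs k) (βs k) xs i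
  have hw := fun i => stepNoise_iterate_properties (αs := αs) (βs := βs) (G := G) (A := A)
    (x₀ := x₀) hcost horacle hrand hσ hγ hB k i
  have hw2 : ∀ i, MemLp (w i) 2 P := fun i => (hw i).1
  have huI : ∀ i, Integrable (fun ω => ‖u i fun j => X j ω‖ ^ 2) P := fun i =>
    (memLp_two_iff_integrable_sq_norm (hu2 i).1).1 (hu2 i)
  have hwI : ∀ i, Integrable (fun ω => ‖w i ω‖ ^ 2) P := fun i =>
    (memLp_two_iff_integrable_sq_norm (hw2 i).1).1 (hw2 i)
  have huwI : ∀ i, Integrable (fun ω => inner ℝ (u i fun j => X j ω) (w i ω)) P := fun i =>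
    integrable_inner_of_memLp (hu2 i) (hw2 i)
  have hXI : ∀ i, Integrable (fun ω => ‖X i ω - xs‖ ^ 2) P := fun i =>
    (memLp_two_iff_integrable_sq_norm ((hX2 i).sub (memLp_const xs)).1).1
      ((hX2 i).sub (memLp_const xs))
  have hstep : ∀ i, ∫ ω, ‖iterate αs βs γs G A g x₀ ξ noise (k + 1) i ω - xs‖ ^ 2 ∂P =
      ∫ ω, ‖u i fun j => X j ω‖ ^ 2 ∂P + αs k ^ 2 * ∫ ω, ‖w i ω‖ ^ 2 ∂P := by
    intro i
    have hpt : ∀ ω, ‖iterate αs βs γs G A g x₀ ξ noise (k + 1) i ω - xs‖ ^ 2 =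
        ‖u i fun j => X j ω‖ ^ 2 - 2 * αs k * inner ℝ (u i fun j => X j ω) (w i ω)
          + αs k ^ 2 * ‖w i ω‖ ^ 2 := by
      intro ω
      rw [iterate_succ_sub (D := D) (l := l) (hγ k) i ω xs, norm_sub_sq_real,
        real_inner_smul_right, norm_smul, mul_pow, Real.norm_eq_abs, sq_abs, ← mul_assoc]
    simp only [hpt]
    have hsub : Integrable (fun ω => ‖u i fun j => X j ω‖ ^ 2 -
        2 * αs k * inner ℝ (u i fun j => X j ω) (w i ω)) P :=
      (huI i).sub ((huwI i).const_mul _)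
    -- The cross term vanishes because `u i` depends on the current state only.
    rw [integral_add hsub ((hwI i).const_mul _), integral_sub (huI i) ((huwI i).const_mul _), integral_const_mul, integral_const_mul,
      (hw i).2.2 (u i) (hu i) (hu2 i)]
    ring
  simp only [hstep, Finset.sum_add_distrib, ← Finset.mul_sum]
  have h1 : ∑ i, ∫ ω, ‖u i fun j => X j ω‖ ^ 2 ∂P ≤
      ρ * ∑ i, ∫ ω, ‖X i ω - xs‖ ^ 2 ∂P + R := by
    rw [← integral_finsetSum _ fun i _ => huI i, ← integral_finsetSum _ fun i _ => hXI i]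
    calc ∫ ω, ∑ i, ‖u i fun j => X j ω‖ ^ 2 ∂P
        ≤ ∫ ω, (ρ * ∑ i, ‖X i ω - xs‖ ^ 2 + R) ∂P :=
          integral_mono (integrable_finsetSum _ fun i _ => huI i)
            (((integrable_finsetSum _ fun i _ => hXI i).const_mul ρ).add (integrable_const R))
            fun ω => hdet fun j => X j ω
      _ = _ := by
          rw [integral_add ((integrable_finsetSum _ fun i _ => hXI i).const_mul ρ)
            (integrable_const R), integral_const_mul]
          simp
  have h2 : ∑ i, ∫ ω, ‖w i ω‖ ^ 2 ∂P ≤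
      Fintype.card V * (2 * B + 2 * (d * (2 * σ k ^ 2))) := by
    calc ∑ i, ∫ ω, ‖w i ω‖ ^ 2 ∂P ≤ ∑ _i : V, (2 * B + 2 * (d * (2 * σ k ^ 2))) :=
          Finset.sum_le_sum fun i _ => (hw i).2.1
      _ = _ := by rw [Finset.sum_const, Finset.card_univ, nsmul_eq_mul]
  have h3 := mul_le_mul_of_nonneg_left h2 (sq_nonneg (αs k))
  linarith

end ExpectedDescent

/-! ### Polynomial step sizes and the scalar recursion -/

section Recursion

theorem tendsto_natCast_add_atTop (a : ℝ) : Tendsto (fun k : ℕ => (k : ℝ) + a) atTop atTop :=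
  tendsto_atTop_add_const_right _ a tendsto_natCast_atTop_atTop

theorem tendsto_stepSize (a₁ a₂ : ℝ) {p : ℝ} (hp : 0 < p) :
    Tendsto (stepSize a₁ a₂ p) atTop (nhds 0) :=
  ((tendsto_rpow_atTop hp).comp (tendsto_natCast_add_atTop a₂)).const_div_atTop a₁

/-- Combines `log (1 + 1/t) ≤ 1/t` with `1 + s ≤ exp s`. It measures how much the target `t^(-p)`
shrinks in one step. -/
theorem rpow_neg_mul_one_sub_le {t p : ℝ} (ht : 0 < t) (hp : 0 ≤ p) :
    t ^ (-p) * (1 - p / t) ≤ (t + 1) ^ (-p) := by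
  have h1 : t + 1 = t * (1 + 1 / t) := by field_simp
  have hpos : 0 < 1 + 1 / t := by positivity
  rw [h1, Real.mul_rpow ht.le hpos.le]
  refine mul_le_mul_of_nonneg_left ?_ (by positivity)
  rw [Real.rpow_def_of_pos hpos]
  have h2 : Real.log (1 + 1 / t) ≤ 1 / t := by
    have := Real.log_le_sub_one_of_pos hpos
    linarith
  have h3 := Real.add_one_le_exp (Real.log (1 + 1 / t) * -p)
  have h4 : Real.log (1 + 1 / t) * p ≤ 1 / t * p := mul_le_mul_of_nonneg_right h2 hp
  have h5 : p / t = 1 / t * p := by ring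
  linarith

/-- A form of Chung's lemma: a perturbed contraction with polynomial step sizes decays at the rate
given by the perturbation. -/
theorem exists_bound_of_recursion {u : ℕ → ℝ} {a c C δ p α : ℝ} (ha : 0 < a) (hα : 0 < α)
    (hp : 0 ≤ p) (hC : 0 ≤ C) (hδ : 0 < δ)
    (hgap : ∀ᶠ k : ℕ in atTop, δ ≤ c - p * ((k : ℝ) + a) ^ (α - 1))
    (hrec : ∀ᶠ k : ℕ in atTop, u (k + 1) ≤
      (1 - c / ((k : ℝ) + a) ^ α) * u k + C * ((k : ℝ) + a) ^ (-(α + p))) :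
    ∃ M : ℝ, 0 ≤ M ∧ ∀ᶠ k : ℕ in atTop, u k ≤ M * ((k : ℝ) + a) ^ (-p) := by
  have hsmall : ∀ᶠ k : ℕ in atTop, c / ((k : ℝ) + a) ^ α ≤ 1 :=
    (tendsto_stepSize c a hα).eventually_le_const one_pos
  obtain ⟨k₀, hk₀⟩ := eventually_atTop.1 (hgap.and (hrec.and hsmall))
  -- In the constant `M`, the first entry absorbs the perturbation and the second starts the
  -- induction at `k₀`.
  have hM0 : 0 ≤ max (C / δ) (u k₀ * ((k₀ : ℝ) + a) ^ p) :=
    le_max_of_le_left (div_nonneg hC hδ.le)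
  have hMC : C ≤ max (C / δ) (u k₀ * ((k₀ : ℝ) + a) ^ p) * δ :=
    (div_le_iff₀ hδ).1 (le_max_left _ _)
  refine ⟨max (C / δ) (u k₀ * ((k₀ : ℝ) + a) ^ p), hM0, eventually_atTop.2 ⟨k₀, fun k hk => ?_⟩⟩
  have hMu : u k₀ * ((k₀ : ℝ) + a) ^ p ≤ max (C / δ) (u k₀ * ((k₀ : ℝ) + a) ^ p) :=
    le_max_right _ _
  generalize max (C / δ) (u k₀ * ((k₀ : ℝ) + a) ^ p) = M at hM0 hMC hMu
  induction k, hk using Nat.le_induction with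
  | base =>
    have ht : 0 < (k₀ : ℝ) + a := by positivity
    rw [Real.rpow_neg ht.le, ← div_eq_mul_inv, le_div_iff₀ (by positivity)]
    exact hMu
  | succ k hk ih =>
    obtain ⟨hg, hr, hs⟩ := hk₀ k hk
    have ht : 0 < (k : ℝ) + a := by positivity
    have hcast : ((k + 1 : ℕ) : ℝ) + a = (k : ℝ) + a + 1 := by push_cast; ring
    rw [hcast]
    generalize (k : ℝ) + a = t at *
    have h1 := mul_le_mul_of_nonneg_left ih (sub_nonneg.2 hs)
    have h2 := mul_le_mul_of_nonneg_left (rpow_neg_mul_one_sub_le ht hp) hM0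
    have h3 : t ^ (-(α + p)) = t ^ (-α) * t ^ (-p) := by rw [← Real.rpow_add ht]; ring_nf
    -- The shrinkage `p / t` is put on the scale `t^(-α)` of the contraction; the induction then
    -- closes when `C ≤ M (c - p t^(α-1))`.
    have h4 : p / t = t ^ (-α) * (p * t ^ (α - 1)) := by
      rw [mul_left_comm, ← Real.rpow_add ht]
      rw [show -α + (α - 1) = -1 by ring, Real.rpow_neg_one, div_eq_mul_inv]
    have h5 : c / t ^ α = c * t ^ (-α) := by rw [Real.rpow_neg ht.le, div_eq_mul_inv]
    rw [h3] at hr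
    rw [h4] at h2
    rw [h5] at hr h1
    have h6 : C ≤ M * (c - p * t ^ (α - 1)) := hMC.trans (mul_le_mul_of_nonneg_left hg hM0)
    have h7 : 0 ≤ t ^ (-α) * t ^ (-p) := by positivity
    have h8 := mul_le_mul_of_nonneg_right h6 h7
    linarith

/-- The accumulated perturbations of one iteration decay polynomially. -/
theorem exists_perturbation_bound {a₁ a₂ α β η p K N B d' : ℝ} (ha₁ : 0 < a₁) (hβ : 0 ≤ β)
    (hpβ : p ≤ α - β) (hpη : p ≤ α - 2 * η) (hK : 0 ≤ K) (hN : 0 ≤ N) (hB : 0 ≤ B)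
    (hd : 0 ≤ d') {σ : ℕ → ℝ} (hσ : ∀ k, 0 < σ k)
    (hσO : σ =O[atTop] fun k : ℕ => ((k : ℝ) + a₂) ^ η) :
    ∃ C : ℝ, 0 ≤ C ∧ ∀ᶠ k : ℕ in atTop,
      K * (stepSize a₁ a₂ α k ^ 2 + stepSize a₁ a₂ α k ^ 2 / stepSize a₁ a₂ β k)
        + stepSize a₁ a₂ α k ^ 2 * (N * (2 * B + 2 * (d' * (2 * σ k ^ 2))))
        ≤ C * ((k : ℝ) + a₂) ^ (-(α + p)) := by
  obtain ⟨c, hc, hσc⟩ := hσO.exists_pos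
  refine ⟨K * (a₁ ^ 2 + a₁) + a₁ ^ 2 * (N * (2 * B + 2 * (d' * (2 * c ^ 2)))), by positivity, ?_⟩
  filter_upwards [hσc.bound, (tendsto_natCast_add_atTop a₂).eventually_ge_atTop 1] with k hk ht1
  simp only [stepSize]
  have hσk := hσ k
  generalize (k : ℝ) + a₂ = t at *
  generalize σ k = s at *
  have ht : 0 < t := one_pos.trans_le ht1
  rw [Real.norm_of_nonneg hσk.le, Real.norm_of_nonneg (by positivity)] at hk
  have hs2 : s ^ 2 ≤ c ^ 2 * t ^ (2 * η) := by
    have := pow_le_pow_left₀ hσk.le hk 2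
    rwa [mul_pow, ← Real.rpow_natCast (t ^ η), ← Real.rpow_mul ht.le, Nat.cast_ofNat,
      mul_comm η] at this
  have hα2 : (a₁ / t ^ α) ^ 2 = a₁ ^ 2 * t ^ (-(2 * α)) := by
    rw [div_pow, ← Real.rpow_natCast (t ^ α), ← Real.rpow_mul ht.le, Nat.cast_ofNat,
      Real.rpow_neg ht.le, mul_comm α, div_eq_mul_inv]
  have hαβ : (a₁ / t ^ α) ^ 2 / (a₁ / t ^ β) = a₁ * t ^ (-(2 * α - β)) := by
    rw [hα2, show -(2 * α - β) = -(2 * α) + β by ring, Real.rpow_add ht]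
    field_simp
  -- The exponents to compare are `2α`, `2α - β` and `2α - 2η`; the last two are where `hpβ` and
  -- `hpη` are needed.
  have hle : ∀ {e : ℝ}, α + p ≤ e → t ^ (-e) ≤ t ^ (-(α + p)) := fun he =>
    Real.rpow_le_rpow_of_exponent_le ht1 (by linarith)
  have e1 : t ^ (-(2 * α)) ≤ t ^ (-(α + p)) := hle (by linarith)
  have e2 : t ^ (-(2 * α - β)) ≤ t ^ (-(α + p)) := hle (by linarith)
  have e3 : t ^ (-(2 * α)) * s ^ 2 ≤ c ^ 2 * t ^ (-(α + p)) := by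
    calc t ^ (-(2 * α)) * s ^ 2 ≤ t ^ (-(2 * α)) * (c ^ 2 * t ^ (2 * η)) := by gcongr
      _ = c ^ 2 * t ^ (-(2 * α - 2 * η)) := by
          rw [show -(2 * α - 2 * η) = -(2 * α) + 2 * η by ring, Real.rpow_add ht]; ring
      _ ≤ c ^ 2 * t ^ (-(α + p)) :=
          mul_le_mul_of_nonneg_left (hle (by linarith)) (sq_nonneg c)
  rw [hαβ, hα2]
  have f1 : K * (a₁ ^ 2 * t ^ (-(2 * α)) + a₁ * t ^ (-(2 * α - β))) ≤
      K * (a₁ ^ 2 * t ^ (-(α + p)) + a₁ * t ^ (-(α + p))) := by gcongr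
  have f2 : a₁ ^ 2 * N * (2 * B) * t ^ (-(2 * α)) ≤ a₁ ^ 2 * N * (2 * B) * t ^ (-(α + p)) := by
    gcongr
  have f3 : a₁ ^ 2 * N * (4 * d') * (t ^ (-(2 * α)) * s ^ 2) ≤
      a₁ ^ 2 * N * (4 * d') * (c ^ 2 * t ^ (-(α + p))) := by gcongr
  linarith

end Recursion

/-! ### Convergence rates -/

section Rate

variable {V : Type*} [Fintype V] {d : ℕ} {Ξ : V → Type*} {Ω : Type*}
  [∀ i, MeasurableSpace (Ξ i)] [MeasurableSpace Ω]
  {P : Measure Ω} [IsProbabilityMeasure P]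
  {D : ∀ i, Measure (Ξ i)} [∀ i, IsProbabilityMeasure (D i)]
  {l : ∀ i, E d → Ξ i → ℝ} {g : ∀ i, E d → Ξ i → E d} {μ : ℝ}
  {G : SimpleGraph V} {A : Matrix V V ℝ} {a₁ a₂ α β η : ℝ} {σ : ℕ → ℝ} {γs : ℕ → ℕ}
  {x₀ : V → E d} {ξ : ∀ (k : ℕ) (i : V), Fin (γs k) → Ω → Ξ i} {noise : ℕ → V → Ω → E d}

theorem exists_rate_bound (hcost : RegularCosts D l μ) (horacle : UnbiasedOracle D l g)
    (hnet : Network G A) (hrand : AlgorithmRandomness P D γs σ ξ noise)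
    (ha₁ : 0 < a₁) (ha₂ : 0 < a₂) (hβ : 0 < β) (hα : 0 < α) (hσ : ∀ k, 0 < σ k)
    (hσO : σ =O[atTop] fun k : ℕ => ((k : ℝ) + a₂) ^ η) (hγ : ∀ k, 0 < γs k)
    {xs : E d} (hxs : ∑ i, gradient (localCost D l i) xs = 0)
    {p δ : ℝ} (hp : 0 ≤ p) (hpβ : p ≤ α - β) (hpη : p ≤ α - 2 * η) (hδ : 0 < δ)
    (hgap : ∀ᶠ k : ℕ in atTop, δ ≤ a₁ * μ - p * ((k : ℝ) + a₂) ^ (α - 1)) :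
    ∃ M : ℝ, 0 ≤ M ∧ ∀ᶠ k : ℕ in atTop, ∀ i,
      ∫ ω, ‖iterate (stepSize a₁ a₂ α) (stepSize a₁ a₂ β) γs G A g x₀ ξ noise k i ω - xs‖ ^ 2 ∂P
        ≤ M * ((k : ℝ) + a₂) ^ (-p) := by
  obtain ⟨L, hL0, hL⟩ := hcost.exists_uniform_lipschitz
  obtain ⟨B, hB0, hB⟩ := horacle.exists_error_bound
  obtain ⟨K, hK0, hK⟩ := hnet.exists_descent_bound (fun i => gradient (localCost D l i)) xs hL
    hcost.strongly_convex hxs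
  obtain ⟨C, hC0, hC⟩ := exists_perturbation_bound (K := K) (N := Fintype.card V) (B := B)
    (d' := d) ha₁ hβ.le hpβ hpη hK0 (Nat.cast_nonneg _) hB0 (Nat.cast_nonneg _) hσ hσO
  obtain ⟨M, hM0, hM⟩ := exists_bound_of_recursion (c := a₁ * μ) (C := C)
    (u := fun k => ∑ i, ∫ ω, ‖iterate (stepSize a₁ a₂ α) (stepSize a₁ a₂ β) γs G A g x₀ ξ noise
      k i ω - xs‖ ^ 2 ∂P) ha₂ hα hp hC0 hδ hgap (by
    -- The smallness conditions of the descent bound hold eventually because both step sizes tend to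
    -- zero.
    have hb : ∀ᶠ k : ℕ in atTop, stepSize a₁ a₂ β k ≤ 1 / 4 :=
      (tendsto_stepSize a₁ a₂ hβ).eventually_le_const (by norm_num)
    have hmul : Tendsto (fun k => 4 * stepSize a₁ a₂ α k * L ^ 2) atTop (nhds 0) := by
      simpa using ((tendsto_stepSize a₁ a₂ hα).const_mul 4).mul_const (L ^ 2)
    filter_upwards [hb, hmul.eventually_le_const hcost.mu_pos, hC] with k hb hmul hC
    have ha0 : 0 ≤ stepSize a₁ a₂ α k := by unfold stepSize; positivity
    have hb0 : 0 < stepSize a₁ a₂ β k := by unfold stepSize; positivity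
    have h := integral_iterate_succ_le (αs := stepSize a₁ a₂ α) (βs := stepSize a₁ a₂ β)
      (G := G) (A := A) (x₀ := x₀) hcost horacle hrand hσ hγ hB xs k
      (hK _ _ ha0 hb0 hb hmul)
    have he : a₁ * μ / ((k : ℝ) + a₂) ^ α = stepSize a₁ a₂ α k * μ := by
      unfold stepSize; ring
    rw [he]
    linarith)
  refine ⟨M, hM0, hM.mono fun k hk i => le_trans ?_ hk⟩
  exact Finset.single_le_sum (f := fun i => ∫ ω, ‖iterate (stepSize a₁ a₂ α) (stepSize a₁ a₂ β)
    γs G A g x₀ ξ noise k i ω - xs‖ ^ 2 ∂P)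
    (fun i _ => integral_nonneg fun ω => sq_nonneg _) (Finset.mem_univ i)

end Rate

theorem sampleSize_pos {a₃ a₂ : ℝ} (ha₃ : 0 < a₃) (ha₂ : 0 < a₂) (γ : ℝ) (k : ℕ) :
    0 < sampleSize a₃ a₂ γ k :=
  Nat.ceil_pos.2 (by positivity)

end DPOpt

theorem theorem7 {V : Type*} [Fintype V] {d : ℕ}
    {Ξ : V → Type*} [∀ i, MeasurableSpace (Ξ i)]
    {Ω : Type*} [MeasurableSpace Ω] (P : Measure Ω) [IsProbabilityMeasure P]
    -- the optimization problem, the sampled gradients and the network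
    (D : ∀ i, Measure (Ξ i)) [∀ i, IsProbabilityMeasure (D i)]
    (l : ∀ i, DPOpt.E d → Ξ i → ℝ) (g : ∀ i, DPOpt.E d → Ξ i → DPOpt.E d) (μ : ℝ)
    (G : SimpleGraph V) (A : Matrix V V ℝ)
    (hcost : DPOpt.RegularCosts D l μ) (horacle : DPOpt.UnbiasedOracle D l g)
    (hnet : DPOpt.Network G A)
    -- the parameters
    (a₁ a₂ a₃ α β γ η : ℝ) (ha₁ : 0 < a₁) (ha₂ : 0 < a₂) (ha₃ : 0 < a₃)
    (hβ : 0 < β) (hβα : β < α) (hα : α ≤ 1) (hγ : 0 ≤ γ) (hη : 0 ≤ η)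
    (hη' : η ≤ min (β / 2) ((α - β) / 2))
    (σ : ℕ → ℝ) (hσ : ∀ k, 0 < σ k) (hσO : σ =O[atTop] fun k : ℕ => ((k : ℝ) + a₂) ^ η)
    -- the initial values, the samples and the privacy noise
    (x₀ : V → DPOpt.E d)
    (ξ : ∀ (k : ℕ) (i : V), Fin (DPOpt.sampleSize a₃ a₂ γ k) → Ω → Ξ i)
    (noise : ℕ → V → Ω → DPOpt.E d)
    (hrand : DPOpt.AlgorithmRandomness P D (DPOpt.sampleSize a₃ a₂ γ) σ ξ noise)
    -- the iterates of the algorithm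
    (x : ℕ → V → Ω → DPOpt.E d)
    (hx : x = DPOpt.iterate (DPOpt.stepSize a₁ a₂ α) (DPOpt.stepSize a₁ a₂ β)
      (DPOpt.sampleSize a₃ a₂ γ) G A g x₀ ξ noise) :
    ∃ xs : DPOpt.E d,
      (∀ y, DPOpt.globalCost D l xs ≤ DPOpt.globalCost D l y) ∧
      (∀ y, (∀ z, DPOpt.globalCost D l y ≤ DPOpt.globalCost D l z) → y = xs) ∧
      (∀ k i, Integrable (fun ω => ‖x k i ω - xs‖ ^ 2) P) ∧
      (α < 1 → ∀ i, (fun k : ℕ => ∫ ω, ‖x k i ω - xs‖ ^ 2 ∂P) =O[atTop]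
        fun k : ℕ => 1 / ((k : ℝ) + a₂) ^ min (β - 2 * η) (α - β - 2 * η)) ∧
      (α = 1 → ∀ i, (fun k : ℕ => ∫ ω, ‖x k i ω - xs‖ ^ 2 ∂P) =O[atTop]
        fun k : ℕ => Real.log k /
          ((k : ℝ) + a₂) ^ min (a₁ * μ - 1 + β) (min (β - 2 * η) (1 - β - 2 * η))) := by
  obtain ⟨hηβ, hηα⟩ := le_min_iff.1 hη'
  have := hnet.connected.nonempty
  have hγpos := DPOpt.sampleSize_pos ha₃ ha₂ γ
  obtain ⟨xs, hxs, hmin⟩ := hcost.exists_minimizer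
  subst hx
  have hα0 : 0 < α := hβ.trans hβα
  refine ⟨xs, fun y => ?_, fun y hy => ?_, fun k i => ?_, fun hα1 i => ?_, fun hα1 i => ?_⟩
  · rcases eq_or_ne y xs with rfl | hne
    · exact le_rfl
    · exact (hmin y hne).le
  · by_contra hne
    exact (hmin y hne).not_ge (hy xs)
  · have h := (DPOpt.memLp_iterate (αs := DPOpt.stepSize a₁ a₂ α) (βs := DPOpt.stepSize a₁ a₂ β)
      (G := G) (A := A) (x₀ := x₀) hcost horacle hrand hσ hγpos k i).sub (memLp_const xs)
    exact (memLp_two_iff_integrable_sq_norm h.1).1 h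
  -- For `α < 1` the loss `p t^(α-1)` tends to zero, so half of `a₁ μ` eventually remains as the
  -- gap.
  · have hlim : Tendsto (fun k : ℕ => a₁ * μ - min (β - 2 * η) (α - β - 2 * η) *
        ((k : ℝ) + a₂) ^ (α - 1)) atTop (nhds (a₁ * μ)) := by
      have h := (tendsto_rpow_neg_atTop (sub_pos.2 hα1)).comp (DPOpt.tendsto_natCast_add_atTop a₂)
      rw [neg_sub] at h
      simpa using (h.const_mul (min (β - 2 * η) (α - β - 2 * η))).const_sub (a₁ * μ)
    have hpos : 0 < a₁ * μ := mul_pos ha₁ hcost.mu_pos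
    obtain ⟨M, -, hM⟩ := DPOpt.exists_rate_bound (x₀ := x₀) hcost horacle hnet hrand ha₁ ha₂ hβ
      hα0 hσ hσO hγpos hxs (p := min (β - 2 * η) (α - β - 2 * η)) (δ := a₁ * μ / 2)
      (le_min (by linarith) (by linarith)) ((min_le_right _ _).trans (by linarith))
      ((min_le_left _ _).trans (by linarith)) (half_pos hpos)
      (hlim.eventually_const_le (half_lt_self hpos))
    refine IsBigO.of_bound M (hM.mono fun k hk => ?_)
    have ht : 0 < (k : ℝ) + a₂ := by positivity
    rw [Real.norm_of_nonneg (integral_nonneg fun ω => sq_nonneg _),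
      Real.norm_of_nonneg (by positivity), one_div, ← Real.rpow_neg ht.le]
    exact hk i
  · subst hα1
    set q := min (β - 2 * η) (1 - β - 2 * η) with hq
    have hq0 : 0 ≤ q := le_min (by linarith) (by linarith)
    set p := min (a₁ * μ - 1 + β) q with hp
    have hpos : 0 < a₁ * μ := mul_pos ha₁ hcost.mu_pos
    -- `p` is negative when `a₁ μ < 1 - β`; boundedness, the rate with exponent `0`, is then more
    -- than enough.
    have hpq : max p 0 ≤ q := max_le (min_le_right _ _) hq0
    -- For `α = 1` the loss is the constant exponent itself, and `β < 1` keeps it strictly below `a₁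
    -- μ`.
    have hgap : max p 0 < a₁ * μ :=
      max_lt ((min_le_left _ _).trans_lt (by linarith)) hpos
    obtain ⟨M, hM0, hM⟩ := DPOpt.exists_rate_bound (x₀ := x₀) hcost horacle hnet hrand ha₁ ha₂ hβ
      hα0 hσ hσO hγpos hxs (p := max p 0) (δ := a₁ * μ - max p 0)
      (le_max_right _ _) (hpq.trans ((min_le_right _ _).trans (by linarith)))
      (hpq.trans ((min_le_left _ _).trans (by linarith))) (sub_pos.2 hgap)
      (Eventually.of_forall fun k => by simp)
    -- The bound holds without the logarithm, which is inserted using `1 ≤ log k` for large `k`.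
    refine IsBigO.of_bound M ?_
    filter_upwards [hM, (DPOpt.tendsto_natCast_add_atTop a₂).eventually_ge_atTop 1,
      (Real.tendsto_log_atTop.comp tendsto_natCast_atTop_atTop).eventually_ge_atTop 1]
      with k hk ht1 hlog
    have ht : 0 < (k : ℝ) + a₂ := by positivity
    have hlog' : 1 ≤ Real.log k := hlog
    rw [Real.norm_of_nonneg (integral_nonneg fun ω => sq_nonneg _),
      Real.norm_of_nonneg (by positivity)]
    refine (hk i).trans (mul_le_mul_of_nonneg_left ?_ hM0)
    calc ((k : ℝ) + a₂) ^ (-max p 0) ≤ ((k : ℝ) + a₂) ^ (-p) :=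
          Real.rpow_le_rpow_of_exponent_le ht1 (neg_le_neg (le_max_left _ _))
      _ = 1 / ((k : ℝ) + a₂) ^ p := by rw [Real.rpow_neg ht.le, one_div]
      _ ≤ Real.log k / ((k : ℝ) + a₂) ^ p := by gcongr
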